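/- Let $c\in\mathbb C$, $a(x)=\frac{x}{x+ic}$, $b(x)=\frac{ic}{x+ic}$, and let the grading be $(-,-,+)$, i.e. $p(1)=p(2)=1$, $p(3)=0$ in $\mathbb Z_2$. For $\alpha,\beta,\gamma,\delta\in\{1,2,3\}$ put $$R^{\alpha\gamma}_{\beta\delta}(x)=a(x)(-1)^{p(\alpha)p(\gamma)}\delta^\alpha_\beta\delta^\gamma_\delta+b(x)\,\delta^\alpha_\delta\delta^\gamma_\beta,\qquad \check R^{\alpha\gamma}_{\beta\delta}(x)=R^{\gamma\alpha}_{\beta\delta}(x),$$ $$(A\otimes_g B)^{\alpha\gamma}_{\beta\delta}=(-1)^{(p(\alpha)+p(\beta))p(\gamma)}A^\alpha_\beta B^\gamma_\delta .$$ Let $\mathcal H$ be a complex vector space, $S\subseteq\mathbb C$ a set of spectral parameters, and let $\mathcal T(x)=(\mathcal T^\alpha_\beta(x))$, $x\in S$, be $3\times3$ matrices of linear operators on $\mathcal H$ that represent the graded Yang–Baxter algebra: $$\check R(x-y)\bigl(\mathcal T(x)\otimes_g\mathcal T(y)\bigr)=\bigl(\mathcal T(y)\otimes_g\mathcal T(x)\bigr)\check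 R(x-y)\qquad(x,y\in S),$$ where at the pole $x-y=-ic$ of $\check R$ the relation is read with $(x-y+ic)\check R(x-y)$ in place of $\check R(x-y)$. Let $\Omega\ne0$ be a highest vector with parameters $a_1,a_2,a_3$: $\mathcal T^\alpha_\alpha(x)\Omega=a_\alpha(x)\Omega$ and $\mathcal T^\alpha_\beta(x)\Omega=0$ for $\alpha>\beta$, for all $x\in S$. Let $t(x)=-\mathcal T^1_1(x)-\mathcal T^2_2(x)+\mathcal T^3_3(x)$ be the transfer matrix (the supertrace of $\mathcal T(x)$). Let $N,M\ge0$, let $\lambda_1,\dots,\lambda_N\in S$ be pairwise distinct and $\mu_1,\dots,\mu_M\in S$ pairwise distinct, with $\lambda_j\neq\mu_k$, $\lambda_j-\mu_k\ne -ic$, $\lambda_j-\lambda_l\neq-ic$ for $j\ne l$, $a_2(\lambda_j)\ne0$ and $a_2(\mu_k)\neq0$, so that the following Bethe equations are well defined, and suppose that they hold: $$\frac{a_1(\lambda_j)}{a_2(\lambda_j)}=\prod_{l\ne j}\frac{a(\lambda_j-\lambda_l)}{a(\lambda_l-\lambda_j)}\prod_{k=1}^M\frac1{a(\lambda_j-\mu_k)}\quad(1\le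 j\le N),\qquad \frac{a_3(\mu_k)}{a_2(\mu_k)}=\prod_{j=1}^N\frac1{a(\lambda_j-\mu_k)}\quad(1\le k\le M).$$ The vector $\Phi$ is built as follows. On $(\mathbb C^2)^{\otimes N}$, with $p'(1)=0$, $p'(2)=1$ and matrix units $e_\alpha^\beta$ (entry $1$ in row $\alpha$, column $\beta$), let $$(e_j)_\alpha^\beta=\sum_{\gamma_1,\dots,\gamma_{j-1}}(-1)^{(p'(\alpha)+p'(\beta))\sum_{k<j}p'(\gamma_k)}\,e_{\gamma_1}^{\gamma_1}\otimes\cdots\otimes e_{\gamma_{j-1}}^{\gamma_{j-1}}\otimes e_\alpha^\beta\otimes I_2^{\otimes(N-j)},$$ $$\mathcal L_j(x)=a(x)I_2+b(x)\begin{pmatrix}(e_j)_1^1&(e_j)_2^1\\(e_j)_1^2&-(e_j)_2^2\end{pmatrix},\qquad \mathcal T_{(+-)}(x)=\mathcal L_N(\lambda_N-x)\cdots\mathcal L_1(\lambda_1-x),$$ $$\mathcal D(x)=\begin{pmatrix}\mathcal T^2_2(x)&\mathcal T^2_3(x)(\sigma^z)^{\otimes N}\\ \mathcal T^3_2(x)(\sigma^z)^{\otimes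 N}&\mathcal T^3_3(x)\end{pmatrix},\qquad \begin{pmatrix}\tilde A(x)&\tilde B(x)\\ \tilde C(x)&\tilde D(x)\end{pmatrix}=\mathcal D(x)\,\mathcal T_{(+-)}(x),$$ where entries of the last two matrices act on $(\mathbb C^2)^{\otimes N}\otimes\mathcal H$. Let $\varphi=\tilde B(\mu_1)\cdots\tilde B(\mu_M)\binom10^{\otimes N}$, a column vector with $2^N$ entries $\varphi^{i_1\dots i_N}\in\operatorname{End}\mathcal H$, and, with $B_1=\mathcal T^1_2$, $B_2=\mathcal T^1_3$, $$\Phi=\sum_{i_1,\dots,i_N=1}^2B_{i_1}(\lambda_1)\cdots B_{i_N}(\lambda_N)\,\varphi^{i_1\dots i_N}\,\Omega\in\mathcal H .$$ Then for every $x\in S$ different from all $\lambda_j$ and all $\mu_k$ one has $t(x)\Phi=\Lambda_{(--+)}(x)\Phi$, where $$\Lambda_{(--+)}(x)=-a_1(x)\prod_{j=1}^N\frac1{a(x-\lambda_j)}-a_2(x)\prod_{j=1}^N\frac1{a(\lambda_j-x)}\prod_{k=1}^M\frac1{a(x-\mu_k)}+a_3(x)\prod_{k=1}^M\frac1{a(x-\mu_k)}$$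 (with $\frac1{a(y)}=\frac{y+ic}{y}$, which is $0$ at $y=-ic\neq0$). In particular, if $\Phi\ne0$, then $\Phi$ is an eigenvector of $t(x)$ with eigenvalue $\Lambda_{(--+)}(x)$. -/

import Mathlib

noncomputable section

namespace GradedBethe

/-- The rational function `a(x) = x / (x + i c)`. -/
def aFun (c x : ℂ) : ℂ := x / (x + Complex.I * c)

/-- The rational function `b(x) = i c / (x + i c)`. -/
def bFun (c x : ℂ) : ℂ := Complex.I * c / (x + Complex.I * c)

/-- The sign `(-1)^p` of a parity `p`. -/
def sgn (p : ZMod 2) : ℂ := if p = 0 then 1 else -1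

/-- The matrix with entries
`R^{αγ}_{βδ} = a (-1)^{p(α)p(γ)} δ^α_β δ^γ_δ + b δ^α_δ δ^γ_β`,
with row `(α, γ)` and column `(β, δ)`. -/
def rOf {n : ℕ} (p : Fin n → ZMod 2) (a b : ℂ) : Matrix (Fin n × Fin n) (Fin n × Fin n) ℂ :=
  fun r s =>
    a * sgn (p r.1 * p r.2) * (if r.1 = s.1 ∧ r.2 = s.2 then 1 else 0) +
      b * (if r.1 = s.2 ∧ r.2 = s.1 then 1 else 0)

/-- Switching the two row indices: `Ř^{αγ}_{βδ} = R^{γα}_{βδ}`. -/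
def switchRows {n : ℕ} (R : Matrix (Fin n × Fin n) (Fin n × Fin n) ℂ) :
    Matrix (Fin n × Fin n) (Fin n × Fin n) ℂ :=
  fun r s => R r.swap s

/-- The rational `R`-matrix with parity function `p` and coupling `c`. -/
def rMatrix {n : ℕ} (p : Fin n → ZMod 2) (c x : ℂ) :
    Matrix (Fin n × Fin n) (Fin n × Fin n) ℂ :=
  rOf p (aFun c x) (bFun c x)

/-- The matrix `Ř(x)`. -/
def rCheck {n : ℕ} (p : Fin n → ZMod 2) (c x : ℂ) :
    Matrix (Fin n × Fin n) (Fin n × Fin n) ℂ :=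
  switchRows (rMatrix p c x)

/-- The matrix `(x + i c) Ř(x)`, which has no pole at `x = - i c`. -/
def rCheckReg {n : ℕ} (p : Fin n → ZMod 2) (c x : ℂ) :
    Matrix (Fin n × Fin n) (Fin n × Fin n) ℂ :=
  switchRows (rOf p x (Complex.I * c))

theorem rCheckReg_eq {n : ℕ} (p : Fin n → ZMod 2) (c x : ℂ) (hx : x + Complex.I * c ≠ 0) :
    rCheckReg p c x = (x + Complex.I * c) • rCheck p c x := by
  ext r s
  simp only [rCheckReg, rCheck, switchRows, rMatrix, rOf, aFun, bFun, Matrix.smul_apply,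
    smul_eq_mul]
  field_simp

/-- The graded tensor product
`(A ⊗_g B)^{αγ}_{βδ} = (-1)^{(p(α) + p(β)) p(γ)} A^α_β B^γ_δ`
of two matrices with entries in an algebra. -/
def gradedTensor {𝒜 : Type*} [Ring 𝒜] [Algebra ℂ 𝒜] {n : ℕ} (p : Fin n → ZMod 2)
    (A B : Matrix (Fin n) (Fin n) 𝒜) : Matrix (Fin n × Fin n) (Fin n × Fin n) 𝒜 :=
  fun r s => sgn ((p r.1 + p s.1) * p r.2) • (A r.1 s.1 * B r.2 s.2)

/-- A complex matrix read as a matrix with entries in an algebra. -/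
def scalarMat {ι : Type*} (𝒜 : Type*) [Ring 𝒜] [Algebra ℂ 𝒜] (m : Matrix ι ι ℂ) :
    Matrix ι ι 𝒜 :=
  m.map (algebraMap ℂ 𝒜)

/-- The relation `K (A ⊗_g B) = (B ⊗_g A) K`. -/
def Intertwines {𝒜 : Type*} [Ring 𝒜] [Algebra ℂ 𝒜] {n : ℕ} (p : Fin n → ZMod 2)
    (K : Matrix (Fin n × Fin n) (Fin n × Fin n) ℂ) (A B : Matrix (Fin n) (Fin n) 𝒜) : Prop :=
  scalarMat 𝒜 K * gradedTensor p A B = gradedTensor p B A * scalarMat 𝒜 K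

/-- `T` represents the graded Yang–Baxter algebra with parity function `p` on the space `H`,
for spectral parameters in the set `S` where the monodromy matrix is defined (it may have poles).
The defining relation `Ř(x - y) (T(x) ⊗_g T(y)) = (T(y) ⊗_g T(x)) Ř(x - y)` is multiplied by the
scalar `x - y + i c`, so that it is free of poles; `intertwines_rCheckReg_iff` below says that
this is the same relation wherever `Ř(x - y)` is defined. -/
def IsYangBaxterRep {H : Type*} [AddCommGroup H] [Module ℂ H] {n : ℕ} (p : Fin n → ZMod 2)
    (c : ℂ) (S : Set ℂ) (T : ℂ → Matrix (Fin n) (Fin n) (Module.End ℂ H)) : Prop :=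
  ∀ x ∈ S, ∀ y ∈ S, Intertwines p (rCheckReg p c (x - y)) (T x) (T y)

theorem intertwines_rCheckReg_iff {𝒜 : Type*} [Ring 𝒜] [Algebra ℂ 𝒜] {n : ℕ}
    (p : Fin n → ZMod 2) (c x : ℂ) (hx : x + Complex.I * c ≠ 0)
    (A B : Matrix (Fin n) (Fin n) 𝒜) :
    Intertwines p (rCheckReg p c x) A B ↔ Intertwines p (rCheck p c x) A B := by
  have h : scalarMat 𝒜 (rCheckReg p c x) =
      (x + Complex.I * c) • scalarMat 𝒜 (rCheck p c x) := by
    rw [rCheckReg_eq p c x hx]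
    ext r s
    simp only [scalarMat, Matrix.map_apply, Matrix.smul_apply, smul_eq_mul, map_mul]
    rw [Algebra.smul_def]
  unfold Intertwines
  rw [h, Matrix.smul_mul, Matrix.mul_smul]
  exact smul_right_injective _ hx |>.eq_iff

/-- The parity function of the grading `(-, -, +)`. -/
def parityMMP : Fin 3 → ZMod 2 := ![1, 1, 0]

/-- The parity function of the induced grading `(+, -)`. -/
def parityPM : Fin 2 → ZMod 2 := ![0, 1]

/-- `Ω` is a highest vector with parameters `a 0, a 1, a 2`: the monodromy matrix acts on it as an
upper triangular matrix with these eigenvalues on the diagonal. -/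
structure IsHighestVector {H : Type*} [AddCommGroup H] [Module ℂ H] (S : Set ℂ)
    (T : ℂ → Matrix (Fin 3) (Fin 3) (Module.End ℂ H)) (a : Fin 3 → ℂ → ℂ) (Ω : H) : Prop where
  ne_zero : Ω ≠ 0
  diag : ∀ x ∈ S, ∀ α, T x α α Ω = a α x • Ω
  lower : ∀ x ∈ S, ∀ α β, β < α → T x α β Ω = 0

/-- The transfer matrix: the supertrace `∑_α (-1)^{p(α)} T^α_α(x)`. -/
def transferMatrix {H : Type*} [AddCommGroup H] [Module ℂ H] {n : ℕ} (p : Fin n → ZMod 2)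
    (T : ℂ → Matrix (Fin n) (Fin n) (Module.End ℂ H)) (x : ℂ) : Module.End ℂ H :=
  ∑ α, sgn (p α) • T x α α

/-! The space `(ℂ²)^{⊗N}` is `(Fin N → Fin 2) → ℂ`, with the standard basis vectors
`e_{i_1} ⊗ ⋯ ⊗ e_{i_N}` labelled by the maps `i : Fin N → Fin 2`; an operator on it is a square
matrix indexed by these maps, and an operator on `(ℂ²)^{⊗N} ⊗ H` is such a matrix with entries
in `End H`. -/

/-- The graded local basis element `(e_j)_α^β`, that is,
`(-1)^{(p(α) + p(β)) ∑_{k<j} p(γ_k)} e_{γ_1}^{γ_1} ⊗ ⋯ ⊗ e_{γ_{j-1}}^{γ_{j-1}} ⊗ e_α^β ⊗ 1 ⊗ ⋯ ⊗ 1`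
(summed over the `γ_k`), where `e_α^β` has its only entry `1` in row `α` and column `β`. -/
def eSite {N : ℕ} (p : Fin 2 → ZMod 2) (j : Fin N) (α β : Fin 2) :
    Matrix (Fin N → Fin 2) (Fin N → Fin 2) ℂ :=
  fun r s =>
    if r j = α ∧ s j = β ∧ ∀ k, k ≠ j → r k = s k then
      sgn ((p α + p β) * ∑ k ∈ Finset.Iio j, p (r k))
    else 0

/-- `σ^z ⊗ ⋯ ⊗ σ^z`. -/
def sigmaZ (N : ℕ) : Matrix (Fin N → Fin 2) (Fin N → Fin 2) ℂ :=
  Matrix.diagonal fun i => ∏ j, (![1, -1] : Fin 2 → ℂ) (i j)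

/-- The elementary `L`-matrix of the gl(1|1) model at site `j`. -/
def lMatrix {N : ℕ} (c : ℂ) (j : Fin N) (x : ℂ) :
    Matrix (Fin 2) (Fin 2) (Matrix (Fin N → Fin 2) (Fin N → Fin 2) ℂ) :=
  !![aFun c x • 1 + bFun c x • eSite parityPM j 0 0, bFun c x • eSite parityPM j 1 0;
     bFun c x • eSite parityPM j 0 1, aFun c x • 1 - bFun c x • eSite parityPM j 1 1]

/-- The monodromy matrix `L_N(λ_N - x) ⋯ L_1(λ_1 - x)` of the auxiliary gl(1|1) problem. -/
def auxMonodromy {N : ℕ} (c : ℂ) (lam : Fin N → ℂ) (x : ℂ) :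
    Matrix (Fin 2) (Fin 2) (Matrix (Fin N → Fin 2) (Fin N → Fin 2) ℂ) :=
  (List.ofFn fun j => lMatrix c j (lam j - x)).reverse.prod

section Nested

variable {H : Type*} [AddCommGroup H] [Module ℂ H]

/-- The operator `m ⊗ X` on `(ℂ²)^{⊗N} ⊗ H`. -/
def tensorOp {ι : Type*} (X : Module.End ℂ H) (m : Matrix ι ι ℂ) :
    Matrix ι ι (Module.End ℂ H) :=
  fun r s => m r s • X

/-- The matrix `𝒟(x)` for the grading `(-, -, +)`. -/
def dMatrix (N : ℕ) (T : ℂ → Matrix (Fin 3) (Fin 3) (Module.End ℂ H)) (x : ℂ) :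
    Matrix (Fin 2) (Fin 2) (Matrix (Fin N → Fin 2) (Fin N → Fin 2) (Module.End ℂ H)) :=
  !![tensorOp (T x 1 1) 1, tensorOp (T x 1 2) (sigmaZ N);
     tensorOp (T x 2 1) (sigmaZ N), tensorOp (T x 2 2) 1]

/-- The nested monodromy matrix `𝒟(x) T_{(+-)}(x)`. -/
def nestedMonodromy {N : ℕ} (c : ℂ) (T : ℂ → Matrix (Fin 3) (Fin 3) (Module.End ℂ H))
    (lam : Fin N → ℂ) (x : ℂ) :
    Matrix (Fin 2) (Fin 2) (Matrix (Fin N → Fin 2) (Fin N → Fin 2) (Module.End ℂ H)) :=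
  dMatrix N T x * (auxMonodromy c lam x).map (scalarMat (Module.End ℂ H))

/-- The column vector `(1, 0)^{⊗N}`. -/
def auxVacuum (N : ℕ) : (Fin N → Fin 2) → ℂ :=
  fun i => ∏ j, (![1, 0] : Fin 2 → ℂ) (i j)

/-- The column vector `φ = B̃(μ_1) ⋯ B̃(μ_M) (1, 0)^{⊗N}`, with entries in `End H`, where `B̃(x)` is
the upper right entry of the nested monodromy matrix. -/
def nestedVector {N M : ℕ} (c : ℂ) (T : ℂ → Matrix (Fin 3) (Fin 3) (Module.End ℂ H))
    (lam : Fin N → ℂ) (mu : Fin M → ℂ) : (Fin N → Fin 2) → Module.End ℂ H :=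
  (List.ofFn fun k => nestedMonodromy c T lam (mu k) 0 1).prod.mulVec
    fun i => algebraMap ℂ (Module.End ℂ H) (auxVacuum N i)

/-- The vector `Φ = ∑ B_{i_1}(λ_1) ⋯ B_{i_N}(λ_N) φ^{i_1 … i_N} Ω`, where
`(B_1(x), B_2(x)) = (T^1_2(x), T^1_3(x))`. -/
def betheVector {N M : ℕ} (c : ℂ) (T : ℂ → Matrix (Fin 3) (Fin 3) (Module.End ℂ H)) (Ω : H)
    (lam : Fin N → ℂ) (mu : Fin M → ℂ) : H :=
  ∑ i : Fin N → Fin 2,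
    (List.ofFn fun j => T (lam j) 0 (i j).succ).prod (nestedVector c T lam mu i Ω)

end Nested

/-- The eigenvalue `Λ_{(--+)}(x)`. At a point where `y = - i c`, a pole of `a`, the factor
`1 / a(y) = (y + i c) / y` takes its value `0`. -/
def eigenvalueMMP {N M : ℕ} (c : ℂ) (a : Fin 3 → ℂ → ℂ) (lam : Fin N → ℂ) (mu : Fin M → ℂ)
    (x : ℂ) : ℂ :=
  -(a 0 x * ∏ j, 1 / aFun c (x - lam j))
    - a 1 x * (∏ j, 1 / aFun c (lam j - x)) * (∏ k, 1 / aFun c (x - mu k))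
    + a 2 x * ∏ k, 1 / aFun c (x - mu k)

/-- The Bethe equations for the grading `(-, -, +)`, for pairwise distinct roots at which both
sides are well defined. -/
structure BetheEquationsMMP {N M : ℕ} (c : ℂ) (a : Fin 3 → ℂ → ℂ) (lam : Fin N → ℂ)
    (mu : Fin M → ℂ) : Prop where
  lam_injective : Function.Injective lam
  mu_injective : Function.Injective mu
  lam_ne_mu : ∀ j k, lam j ≠ mu k
  lam_lam_pole : ∀ j l, j ≠ l → lam j - lam l + Complex.I * c ≠ 0
  lam_mu_pole : ∀ j k, lam j - mu k + Complex.I * c ≠ 0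
  a_lam_ne_zero : ∀ j, a 1 (lam j) ≠ 0
  a_mu_ne_zero : ∀ k, a 1 (mu k) ≠ 0
  eq_lam : ∀ j, a 0 (lam j) / a 1 (lam j) =
    (∏ l ∈ Finset.univ.erase j, aFun c (lam j - lam l) / aFun c (lam l - lam j)) *
      ∏ k, 1 / aFun c (lam j - mu k)
  eq_mu : ∀ k, a 2 (mu k) / a 1 (mu k) = ∏ j, 1 / aFun c (lam j - mu k)

end GradedBethe

end

namespace GradedBethe

/-! Put η = ic, A = T^1_1, B_k for the remaining entries of the first row and D for the lower right
2×2 block, so that t = -A - (D_00 - D_11). The proof is a nested algebraic Bethe ansatz. Moving A(x)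
or D(x) through B(λ_1)⋯B(λ_N) produces a wanted term, in which the B's keep their parameters, and
for every λ_j an unwanted term, in which x has taken the place of λ_j
(`CreationRelations.A_creation`, `CreationRelations.D_creation`). In the wanted term of D the inner
vector φ is acted on by a gl(1|1) monodromy matrix: D(x) times one L-matrix per λ_j.

Two facts about φ are needed. It is an eigenvector of the inner supertrace: D satisfies gl(1|1)
exchange relations, adding sites preserves them, and in this algebra both diagonal entries pass
B̃(μ) with the same factor. What is left over contains the supertrace at some μ_k, acting by a
scalar Γ(μ_k) that vanishes by the second set of Bethe equations (`supertrace_bethe`). Moreover A(y)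
acts on every component of φ by a_1(y) for y outside the μ's, because D creates no component outside
`partialHighest`.

The unwanted terms cancel because the L-matrix of the site λ_j degenerates to η times the graded
permutation at x = λ_j. Once this site has been moved to the front, the inner supertrace at λ_j
becomes the contraction occurring in the unwanted term of D. The eigenvalue equation of φ at λ_j
therefore turns that term into a multiple of the unwanted term of A (`smul_unwanted_eq`), and the
first set of Bethe equations equates the scalars.

The recursions run on `List (Fin 2) → H`, where a site is added by consing an index, and with
L-matrices multiplied by λ_j - x + η. `betheVector_eq` returns to the original vector; the
normalisation is a common scalar. -/

/-- The Koszul sign `(-1)^{q(i) q(j)}` for the parities `q(0) = 0`, `q(1) = 1`. -/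
def koszul (i j : Fin 2) : ℂ := if i = 1 ∧ j = 1 then -1 else 1

@[simp] theorem koszul_zero_left (j : Fin 2) : koszul 0 j = 1 := by simp [koszul]

@[simp] theorem koszul_zero_right (i : Fin 2) : koszul i 0 = 1 := by simp [koszul]

@[simp] theorem koszul_one_one : koszul 1 1 = -1 := by simp [koszul]

theorem fin_two_eq (i : Fin 2) : i = 0 ∨ i = 1 := by omega

/-! ### Tensors of all ranks and the gl(1|1) exchange relations. -/

section Tensors

variable {H : Type*} [AddCommGroup H] [Module ℂ H]

/-- The component of a tensor along a basis vector in the first factor. Tensors with values in `H`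
of all ranks at once are functions `List (Fin 2) → H`. -/
def slice (k : Fin 2) : (List (Fin 2) → H) →ₗ[ℂ] (List (Fin 2) → H) :=
  LinearMap.funLeft ℂ H (List.cons k)

@[simp] theorem slice_apply (k : Fin 2) (ψ : List (Fin 2) → H) (r : List (Fin 2)) :
    slice k ψ r = ψ (k :: r) := rfl

/-- The tensor operator with prescribed components along the first factor. -/
def glue (f : Fin 2 → (List (Fin 2) → H) →ₗ[ℂ] (List (Fin 2) → H)) :
    Module.End ℂ (List (Fin 2) → H) :=
  LinearMap.pi fun l => match l with
    | [] => 0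
    | m :: r => LinearMap.proj r ∘ₗ f m

@[simp] theorem glue_nil (f : Fin 2 → (List (Fin 2) → H) →ₗ[ℂ] (List (Fin 2) → H))
    (ψ : List (Fin 2) → H) : glue f ψ [] = 0 := rfl

@[simp] theorem glue_cons (f : Fin 2 → (List (Fin 2) → H) →ₗ[ℂ] (List (Fin 2) → H))
    (ψ : List (Fin 2) → H) (m : Fin 2) (r : List (Fin 2)) : glue f ψ (m :: r) = f m ψ r := rfl

@[simp] theorem slice_glue (f : Fin 2 → (List (Fin 2) → H) →ₗ[ℂ] (List (Fin 2) → H))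
    (ψ : List (Fin 2) → H) (m : Fin 2) : slice m (glue f ψ) = f m ψ := rfl

/-- Adding a site with `L`-matrix `X + η P` in front of a monodromy matrix. -/
def addSite (η X : ℂ) (M : Matrix (Fin 2) (Fin 2) (Module.End ℂ (List (Fin 2) → H))) :
    Matrix (Fin 2) (Fin 2) (Module.End ℂ (List (Fin 2) → H)) :=
  fun i j => glue fun m => (X * koszul i m * koszul j m) • (M i j ∘ₗ slice m) +
    (if m = j then η * koszul i j else 0) • ∑ n, M i n ∘ₗ slice n

/-- The monodromy matrix with regularised `L`-matrices `(z - x) + η P` at the sites `z`. -/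
def monodromy (η : ℂ) (D : ℂ → Matrix (Fin 2) (Fin 2) (Module.End ℂ H)) (x : ℂ) :
    List ℂ → Matrix (Fin 2) (Fin 2) (Module.End ℂ (List (Fin 2) → H))
  | [] => fun i j => (D x i j).compLeft _
  | z :: zs => addSite η (z - x) (monodromy η D x zs)

theorem addSite_apply_cons (η X : ℂ)
    (M : Matrix (Fin 2) (Fin 2) (Module.End ℂ (List (Fin 2) → H))) (i j m : Fin 2)
    (ψ : List (Fin 2) → H) (r : List (Fin 2)) :
    addSite η X M i j ψ (m :: r) = (X * koszul i m * koszul j m) • M i j (slice m ψ) r +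
      (if m = j then η * koszul i j else 0) • (M i 0 (slice 0 ψ) r + M i 1 (slice 1 ψ) r) := by
  simp [addSite, Fin.sum_univ_two, -ite_smul]

@[simp] theorem addSite_apply_nil (η X : ℂ)
    (M : Matrix (Fin 2) (Fin 2) (Module.End ℂ (List (Fin 2) → H))) (i j : Fin 2)
    (ψ : List (Fin 2) → H) : addSite η X M i j ψ [] = 0 := rfl

theorem slice_addSite (η X : ℂ)
    (M : Matrix (Fin 2) (Fin 2) (Module.End ℂ (List (Fin 2) → H))) (i j m : Fin 2)
    (ψ : List (Fin 2) → H) :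
    slice m (addSite η X M i j ψ) = (X * koszul i m * koszul j m) • M i j (slice m ψ) +
      (if m = j then η * koszul i j else 0) • (M i 0 (slice 0 ψ) + M i 1 (slice 1 ψ)) := by
  ext r; exact addSite_apply_cons ..

/-- The graded exchange relations of the gl(1|1) Yang–Baxter algebra with spectral parameter
difference `u`. -/
def ExchangeRelations {V : Type*} [AddCommGroup V] [Module ℂ V] (η u : ℂ)
    (M K : Matrix (Fin 2) (Fin 2) (Module.End ℂ V)) : Prop :=
  ∀ (α β γ δ : Fin 2) (v : V),
    (u * koszul β α) • M γ β (K α δ v) -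
        (u * (koszul β δ * koszul α γ * koszul δ γ)) • K α δ (M γ β v) +
      (η * (koszul α γ * koszul β γ)) • (K α β (M γ δ v) - M α β (K γ δ v)) = 0

-- The comultiplication property of the graded algebra. A site z contributes X = z - x to M and Y =
-- z - y to K, so Y - X is again the spectral difference x - y.
set_option maxHeartbeats 4000000 in
theorem ExchangeRelations.addSite {η X Y : ℂ}
    {M K : Matrix (Fin 2) (Fin 2) (Module.End ℂ (List (Fin 2) → H))}
    (h : ExchangeRelations η (Y - X) M K) :
    ExchangeRelations η (Y - X) (addSite η X M) (addSite η Y K) := by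
  intro α β γ δ ψ
  ext r
  rcases r with _ | ⟨m, r⟩
  · simp
  have h' : ∀ (α β γ δ : Fin 2) (n : Fin 2), _ := fun α β γ δ n =>
    congrFun (h α β γ δ (slice n ψ)) r
  -- Expand the two site factors X + ηP and Y + ηP. The pieces XY, Xη, Yη and η² each reduce to
  -- instances of the relation for M and K; the conditions on m say where the permutation puts the
  -- new index.
  have h1 := congrArg (fun w : H =>
    (X * Y * (koszul γ m * koszul β m * koszul α m * koszul δ m)) • w) (h' α β γ δ m)
  have h2 := fun n => congrArg (fun w : H =>
    ((if m = δ then X * η else 0) * (koszul γ δ * koszul β δ * koszul α δ)) • w) (h' α β γ n n)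
  have h3 := fun n => congrArg (fun w : H =>
    ((if m = β then Y * η else 0) * (koszul β α * koszul γ β * koszul δ n)) • w) (h' α n γ δ n)
  have h4 := fun n => congrArg (fun w : H =>
    ((if m = β then η ^ 2 else 0) * (koszul β α * koszul γ β)) • w) (h' α δ γ n n)
  have h20 := h2 0
  have h21 := h2 1
  have h30 := h3 0
  have h31 := h3 1
  have h40 := h4 0
  have h41 := h4 1
  rcases fin_two_eq α with rfl | rfl <;> rcases fin_two_eq β with rfl | rfl <;>
    rcases fin_two_eq γ with rfl | rfl <;> rcases fin_two_eq δ with rfl | rfl <;>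
    rcases fin_two_eq m with rfl | rfl <;>
    linear_combination (norm := (
      simp only [Pi.add_apply, Pi.sub_apply, Pi.smul_apply, Pi.zero_apply, addSite_apply_cons,
        slice_addSite, map_add, map_smul, koszul_zero_left, koszul_zero_right, koszul_one_one,
        if_true, zero_ne_one, one_ne_zero, if_false]
      module)) h1 + h20 + h21 + h30 + h31 + h40 + h41

end Tensors
end GradedBethe

/-! ### The gl(1|1) monodromy matrix: Bethe ansatz, reordering of sites, vacuum. -/

namespace GradedBethe

section Monodromy

variable {H : Type*} [AddCommGroup H] [Module ℂ H]

theorem monodromy_nil_apply (η : ℂ) (D : ℂ → Matrix (Fin 2) (Fin 2) (Module.End ℂ H)) (x : ℂ)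
    (i j : Fin 2) (ψ : List (Fin 2) → H) (r : List (Fin 2)) :
    monodromy η D x [] i j ψ r = D x i j (ψ r) := rfl

theorem monodromy_exchange {η x y : ℂ} {D : ℂ → Matrix (Fin 2) (Fin 2) (Module.End ℂ H)}
    (h : ExchangeRelations η (x - y) (D x) (D y)) (zs : List ℂ) :
    ExchangeRelations η (x - y) (monodromy η D x zs) (monodromy η D y zs) := by
  induction zs with
  | nil => exact fun α β γ δ ψ => funext fun r => h α β γ δ (ψ r)
  | cons z zs ih =>
    have e : x - y = (z - y) - (z - x) := by ring
    rw [e] at ih ⊢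
    exact ih.addSite

/-- The supertrace of a monodromy matrix of the gl(1|1) algebra passes the upper right entry. -/
theorem ExchangeRelations.supertrace_mul {V : Type*} [AddCommGroup V] [Module ℂ V] {η x y : ℂ}
    {M : ℂ → Matrix (Fin 2) (Fin 2) (Module.End ℂ V)} (hxy : x ≠ y)
    (h : ExchangeRelations η (x - y) (M x) (M y)) (h' : ExchangeRelations η (y - x) (M y) (M x))
    (v : V) :
    M x 0 0 (M y 0 1 v) - M x 1 1 (M y 0 1 v) =
      ((x - y + η) / (x - y)) • M y 0 1 (M x 0 0 v - M x 1 1 v) -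
        (η / (x - y)) • M x 0 1 (M y 0 0 v - M y 1 1 v) := by
  have hu : x - y ≠ 0 := sub_ne_zero.2 hxy
  have h1 := h' 0 1 0 0 v
  have h2 := h 0 1 1 1 v
  simp only [koszul_zero_left, koszul_zero_right, koszul_one_one] at h1 h2
  have h3 : (x - y) • (M x 0 0 (M y 0 1 v) - M x 1 1 (M y 0 1 v) -
      (((x - y + η) / (x - y)) • M y 0 1 (M x 0 0 v - M x 1 1 v) -
        (η / (x - y)) • M x 0 1 (M y 0 0 v - M y 1 1 v))) = 0 := by
    rw [smul_sub, smul_sub _ (((x - y + η) / (x - y)) • _), smul_smul, smul_smul,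
      mul_div_cancel₀ _ hu, mul_div_cancel₀ _ hu, map_sub, map_sub]
    linear_combination (norm := module) h1 - h2
  exact sub_eq_zero.1 ((smul_eq_zero.1 h3).resolve_left hu)

/-- The algebraic Bethe ansatz of the gl(1|1) model, on shell. -/
theorem supertrace_bethe {V : Type*} [AddCommGroup V] [Module ℂ V] {η : ℂ} {S : Set ℂ}
    {M : ℂ → Matrix (Fin 2) (Fin 2) (Module.End ℂ V)}
    (h : ∀ x ∈ S, ∀ y ∈ S, ExchangeRelations η (x - y) (M x) (M y)) (ω : V) (Γ : ℂ → ℂ)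
    (hω : ∀ x ∈ S, M x 0 0 ω - M x 1 1 ω = Γ x • ω) (mus : List ℂ) (hnd : mus.Nodup)
    (hS : ∀ y ∈ mus, y ∈ S) (hΓ : ∀ y ∈ mus, Γ y = 0) (x : ℂ) (hx : x ∈ S) (hxm : x ∉ mus) :
    M x 0 0 ((mus.map fun y => M y 0 1).prod ω) - M x 1 1 ((mus.map fun y => M y 0 1).prod ω) =
      (Γ x * (mus.map fun y => (x - y + η) / (x - y)).prod) •
        (mus.map fun y => M y 0 1).prod ω := by
  induction mus generalizing x with
  | nil => simpa using hω x hx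
  | cons y ys ih =>
    simp only [List.mem_cons, not_or, forall_eq_or_imp, List.nodup_cons] at *
    have ih' := ih hnd.2 hS.2 hΓ.2
    simp only [List.map_cons, List.prod_cons, Module.End.mul_apply]
    -- The unwanted term contains the supertrace at y on the vector built from ys. By the induction
    -- hypothesis at y it is a multiple of Γ y = 0.
    rw [ExchangeRelations.supertrace_mul hxm.1 (h x hx y hS.1) (h y hS.1 x hx),
      ih' x hx hxm.2, ih' y hS.1 hnd.1, hΓ.1]
    simp only [zero_mul, zero_smul, map_zero, smul_zero, sub_zero, map_smul, smul_smul]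
    congr 1; ring

/-- The graded exchange of the first two tensor factors. -/
def exchange (v : ℂ) : Module.End ℂ (List (Fin 2) → H) :=
  glue fun m => glue fun k => koszul k m • (slice m ∘ₗ slice k) + v • (slice k ∘ₗ slice m)

theorem exchange_apply (v : ℂ) (ψ : List (Fin 2) → H) (m k : Fin 2) (r : List (Fin 2)) :
    exchange v ψ (m :: k :: r) = koszul k m • ψ (k :: m :: r) + v • ψ (m :: k :: r) := rfl

theorem slice_slice_exchange (v : ℂ) (ψ : List (Fin 2) → H) (m k : Fin 2) :
    slice k (slice m (exchange v ψ)) =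
      koszul k m • slice m (slice k ψ) + v • slice k (slice m ψ) := rfl

-- The Yang–Baxter equation for two sites: the graded permutation plus η/(X - Y) intertwines the two
-- orders of the sites.
set_option maxHeartbeats 1000000 in
theorem exchange_addSite {η X Y : ℂ} (hv : X - Y ≠ 0)
    (M : Matrix (Fin 2) (Fin 2) (Module.End ℂ (List (Fin 2) → H))) (i j : Fin 2)
    (ψ : List (Fin 2) → H) :
    exchange (η / (X - Y)) (addSite η Y (addSite η X M) i j ψ) =
      addSite η X (addSite η Y M) i j (exchange (η / (X - Y)) ψ) := by
  -- Writing η as a multiple of X - Y removes all denominators, so that `module` can compare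
  -- coefficients.
  obtain ⟨v, rfl⟩ : ∃ v, η = v * (X - Y) := ⟨η / (X - Y), by field_simp⟩
  rw [mul_div_cancel_right₀ _ hv]
  ext r
  rcases r with _ | ⟨m, _ | ⟨k, r⟩⟩
  · rfl
  · rw [addSite_apply_cons]
    have e : ∀ (i j : Fin 2) (ψ : List (Fin 2) → H),
      addSite (v * (X - Y)) Y M i j ψ [] = 0 := fun _ _ _ => rfl
    rw [e, e, e]
    simp [exchange]
  · rw [exchange_apply]
    rcases fin_two_eq i with rfl | rfl <;> rcases fin_two_eq j with rfl | rfl <;>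
      rcases fin_two_eq m with rfl | rfl <;> rcases fin_two_eq k with rfl | rfl <;>
      (simp only [Pi.add_apply, Pi.smul_apply, addSite_apply_cons,
        map_add, map_smul, koszul_zero_left, koszul_zero_right, koszul_one_one,
        if_true, zero_ne_one, one_ne_zero, if_false, slice_slice_exchange]
       module)

/-- Moving the factor with parameter `y` to the front, past the factors with parameters `pre`. -/
noncomputable def moveFront (η y : ℂ) : List ℂ → Module.End ℂ (List (Fin 2) → H)
  | [] => 1
  | z :: pre => exchange (η / (y - z)) * glue fun m => moveFront η y pre ∘ₗ slice m

theorem addSite_congr_glue {η X : ℂ} (R : Module.End ℂ (List (Fin 2) → H))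
    {M K : Matrix (Fin 2) (Fin 2) (Module.End ℂ (List (Fin 2) → H))}
    (h : ∀ i j ψ, R (M i j ψ) = K i j (R ψ)) (i j : Fin 2) (ψ : List (Fin 2) → H) :
    (glue fun m => R ∘ₗ slice m) (addSite η X M i j ψ) =
      addSite η X K i j ((glue fun m => R ∘ₗ slice m) ψ) := by
  ext r
  rcases r with _ | ⟨m, r⟩
  · rfl
  · rw [glue_cons, LinearMap.comp_apply, slice_addSite, addSite_apply_cons]
    simp only [map_add, map_smul, h, slice_glue, LinearMap.comp_apply]
    rfl

/-- Repeated use of `exchange_addSite`, once for each site that y passes. -/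
theorem moveFront_monodromy {η x y : ℂ} (D : ℂ → Matrix (Fin 2) (Fin 2) (Module.End ℂ H))
    (pre post : List ℂ) (hy : y ∉ pre) (i j : Fin 2) (ψ : List (Fin 2) → H) :
    moveFront η y pre (monodromy η D x (pre ++ y :: post) i j ψ) =
      monodromy η D x (y :: (pre ++ post)) i j (moveFront η y pre ψ) := by
  induction pre generalizing i j ψ with
  | nil => rfl
  | cons z pre ih =>
    simp only [List.mem_cons, not_or] at hy
    have hv : (y - x) - (z - x) ≠ 0 := by simpa [sub_eq_zero] using hy.1
    have e : y - z = (y - x) - (z - x) := by ring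
    simp only [List.cons_append, moveFront, Module.End.mul_apply, monodromy]
    rw [addSite_congr_glue _ (ih hy.2), e]
    simp only [monodromy]
    rw [exchange_addSite hv]

/-- The vacuum `(1, 0)^{⊗N} ⊗ Ω`. -/
def tensorVacuum (Ω : H) : ℕ → List (Fin 2) → H
  | 0, [] => Ω
  | 0, _ :: _ => 0
  | _ + 1, [] => 0
  | n + 1, m :: r => if m = 0 then tensorVacuum Ω n r else 0

theorem slice_tensorVacuum (Ω : H) (n : ℕ) (m : Fin 2) :
    slice m (tensorVacuum Ω (n + 1)) = (if m = 0 then (1 : ℂ) else 0) • tensorVacuum Ω n := by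
  ext r
  by_cases h : m = 0 <;> simp [tensorVacuum, h]

theorem compLeft_tensorVacuum (X : Module.End ℂ H) (Ω : H) (d : ℂ) (h : X Ω = d • Ω) :
    X.compLeft (List (Fin 2)) (tensorVacuum Ω 0) = d • tensorVacuum Ω 0 := by
  ext r
  rcases r with _ | _ <;> simp [tensorVacuum, h]

/-- Triangularity survives the addition of a site: on the index 0 the permutation contributes η to
the entry (0, 0) only, and its contribution to (1, 1) involves the vanishing entry (1, 0). -/
theorem monodromy_tensorVacuum {η x : ℂ} {D : ℂ → Matrix (Fin 2) (Fin 2) (Module.End ℂ H)}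
    {Ω : H} {d₀ d₁ : ℂ} (h₀ : D x 0 0 Ω = d₀ • Ω) (h₁ : D x 1 1 Ω = d₁ • Ω)
    (h₁₀ : D x 1 0 Ω = 0) (zs : List ℂ) :
    monodromy η D x zs 0 0 (tensorVacuum Ω zs.length) =
        (d₀ * (zs.map fun z => z - x + η).prod) • tensorVacuum Ω zs.length ∧
      monodromy η D x zs 1 1 (tensorVacuum Ω zs.length) =
        (d₁ * (zs.map fun z => z - x).prod) • tensorVacuum Ω zs.length ∧
      monodromy η D x zs 1 0 (tensorVacuum Ω zs.length) = 0 := by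
  induction zs with
  | nil =>
    refine ⟨?_, ?_, ?_⟩
    · simpa [monodromy] using compLeft_tensorVacuum _ _ _ h₀
    · simpa [monodromy] using compLeft_tensorVacuum _ _ _ h₁
    · simpa [monodromy] using compLeft_tensorVacuum (D x 1 0) Ω 0 (by simpa using h₁₀)
  | cons z zs ih =>
    obtain ⟨i1, i2, i3⟩ := ih
    refine ⟨?_, ?_, ?_⟩ <;>
    · ext r
      rcases r with _ | ⟨m, r⟩
      · simp [monodromy, tensorVacuum]
      · simp only [monodromy, List.length_cons, addSite_apply_cons, slice_tensorVacuum, map_smul,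
          i1, i2, i3]
        rcases fin_two_eq m with rfl | rfl <;> simp [tensorVacuum, smul_smul]
        all_goals module

end Monodromy
end GradedBethe

/-! ### Moving A and D through the creation operators. -/

namespace GradedBethe

section Creation

variable {H : Type*} [AddCommGroup H] [Module ℂ H]

/-- The map `ψ ↦ ∑ B_{i_1}(z_1) ⋯ B_{i_N}(z_N) ψ^{i_1 … i_N}`. -/
def creation (B : ℂ → Fin 2 → Module.End ℂ H) : List ℂ → (List (Fin 2) → H) →ₗ[ℂ] H
  | [] => LinearMap.proj []
  | z :: zs => ∑ k, B z k ∘ₗ creation B zs ∘ₗ slice k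

theorem creation_nil (B : ℂ → Fin 2 → Module.End ℂ H) (ψ : List (Fin 2) → H) :
    creation B [] ψ = ψ [] := rfl

theorem creation_cons (B : ℂ → Fin 2 → Module.End ℂ H) (z : ℂ) (zs : List ℂ)
    (ψ : List (Fin 2) → H) :
    creation B (z :: zs) ψ =
      B z 0 (creation B zs (slice 0 ψ)) + B z 1 (creation B zs (slice 1 ψ)) := by
  simp [creation, Fin.sum_univ_two]

/-- The sum of `f pre y post` over all decompositions `pre ++ y :: post` of a list. -/
def sumSplits {G : Type*} [AddCommMonoid G] : List ℂ → (List ℂ → ℂ → List ℂ → G) → G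
  | [], _ => 0
  | y :: ys, f => f [] y ys + sumSplits ys fun pre => f (y :: pre)

theorem sumSplits_congr {G : Type*} [AddCommMonoid G] {ls : List ℂ}
    {f g : List ℂ → ℂ → List ℂ → G}
    (h : ∀ pre y post, ls = pre ++ y :: post → f pre y post = g pre y post) :
    sumSplits ls f = sumSplits ls g := by
  induction ls generalizing f g with
  | nil => rfl
  | cons z zs ih =>
    simp only [sumSplits]
    rw [h [] z zs rfl, ih fun pre y post e => h (z :: pre) y post (by simp [e])]

theorem sumSplits_add {G : Type*} [AddCommMonoid G] (ls : List ℂ)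
    (f g : List ℂ → ℂ → List ℂ → G) :
    sumSplits ls f + sumSplits ls g =
      sumSplits ls fun pre y post => f pre y post + g pre y post := by
  induction ls generalizing f g with
  | nil => simp [sumSplits]
  | cons z zs ih => simp only [sumSplits, ← ih]; abel

theorem map_sumSplits {G K : Type*} [AddCommMonoid G] [AddCommMonoid K] [Module ℂ G] [Module ℂ K]
    (X : G →ₗ[ℂ] K) (ls : List ℂ) (f : List ℂ → ℂ → List ℂ → G) :
    X (sumSplits ls f) = sumSplits ls fun pre y post => X (f pre y post) := by
  induction ls generalizing f with
  | nil => simp [sumSplits]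
  | cons z zs ih => simp only [sumSplits, map_add, ih]

theorem smul_sumSplits (c : ℂ) (ls : List ℂ) (f : List ℂ → ℂ → List ℂ → H) :
    c • sumSplits ls f = sumSplits ls fun pre y post => c • f pre y post :=
  map_sumSplits (LinearMap.lsmul ℂ H c) ls f

theorem sub_sumSplits {G : Type*} [AddCommGroup G] (ls : List ℂ)
    (f g : List ℂ → ℂ → List ℂ → G) :
    sumSplits ls f - sumSplits ls g =
      sumSplits ls fun pre y post => f pre y post - g pre y post := by
  rw [sub_eq_iff_eq_add, sumSplits_add]
  simp

/-- The exchange relations of the creation operators `B` with each other, with the operator `A`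
and with the operators `D`. -/
structure CreationRelations (η : ℂ) (S : Set ℂ) (A : ℂ → Module.End ℂ H)
    (B : ℂ → Fin 2 → Module.End ℂ H) (D : ℂ → Matrix (Fin 2) (Fin 2) (Module.End ℂ H)) :
    Prop where
  mul_B : ∀ x ∈ S, ∀ y ∈ S, ∀ (j k : Fin 2) (v : H),
    (x - y - η) • B x j (B y k v) = ((x - y) * koszul j k) • B y k (B x j v) - η • B y j (B x k v)
  A_B : ∀ x ∈ S, ∀ y ∈ S, x ≠ y → ∀ (k : Fin 2) (v : H),
    A x (B y k v) = (1 + η / (x - y)) • B y k (A x v) - (η / (x - y)) • B x k (A y v)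
  D_B : ∀ x ∈ S, ∀ y ∈ S, x ≠ y → ∀ (i j k : Fin 2) (v : H),
    D x i j (B y k v) = (koszul i k * koszul j k) • B y k (D x i j v) -
      (η / (x - y) * koszul i j) • (B y j (D x i k v) - B x j (D y i k v))

@[simp] theorem koszul_mul_self (i j : Fin 2) : koszul i j * koszul i j = 1 := by
  unfold koszul; split_ifs <;> norm_num

section Pass

variable {η : ℂ} {S : Set ℂ} {A : ℂ → Module.End ℂ H} {B : ℂ → Fin 2 → Module.End ℂ H}
  {D : ℂ → Matrix (Fin 2) (Fin 2) (Module.End ℂ H)}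

theorem CreationRelations.reorder (h : CreationRelations η S A B D) {x z : ℂ} (hx : x ∈ S)
    (hz : z ∈ S) (hxz : x ≠ z) (k m : Fin 2) (v : H) :
    (1 + η / (x - z)) • B z k (B x m v) =
      koszul k m • B x m (B z k v) + (η / (x - z)) • B x k (B z m v) := by
  have hu : x - z ≠ 0 := sub_ne_zero.2 hxz
  obtain ⟨b, rfl⟩ : ∃ b, η = b * (x - z) := ⟨η / (x - z), by field_simp⟩
  rw [mul_div_cancel_right₀ _ hu]
  have h1 := h.mul_B z hz x hx k m v
  rw [← sub_eq_zero]
  refine (smul_eq_zero.1 (?_ : (x - z) • (_ : H) = 0)).resolve_left hu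
  linear_combination (norm := module) -h1

theorem CreationRelations.reorder' (h : CreationRelations η S A B D) {x z : ℂ} (hx : x ∈ S)
    (hz : z ∈ S) (hxz : x ≠ z) (j k : Fin 2) (v : H) :
    koszul j k • B z k (B x j v) - (η / (x - z)) • B z j (B x k v) =
      (1 - η / (x - z)) • B x j (B z k v) := by
  have hu : x - z ≠ 0 := sub_ne_zero.2 hxz
  obtain ⟨b, rfl⟩ : ∃ b, η = b * (x - z) := ⟨η / (x - z), by field_simp⟩
  rw [mul_div_cancel_right₀ _ hu]
  have h1 := h.mul_B x hx z hz j k v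
  rw [← sub_eq_zero]
  refine (smul_eq_zero.1 (?_ : (x - z) • (_ : H) = 0)).resolve_left hu
  linear_combination (norm := module) -h1

/-- The scalar identity through which two successive exchanges of parameters combine into one. -/
theorem partial_fractions (η : ℂ) {x y z : ℂ} (hxy : x ≠ y) (hxz : x ≠ z) (hzy : z ≠ y) :
    η / (x - y) * (η / (x - z)) - η / (x - z) * (η / (z - y)) + η / (x - y) * (η / (z - y)) =
      0 := by
  have h1 := sub_ne_zero.2 hxy
  have h2 := sub_ne_zero.2 hxz
  have h3 := sub_ne_zero.2 hzy
  field_simp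
  ring

/-- The vector multiplying `B_m(x)` in the term of `A(x) B(z_1) ⋯ B(z_N) ψ` where the parameters
`x` and `y` are exchanged. -/
noncomputable def unwantedA (η : ℂ) (A : ℂ → Module.End ℂ H) (B : ℂ → Fin 2 → Module.End ℂ H) (pre : List ℂ)
    (y : ℂ) (post : List ℂ) (ψ : List (Fin 2) → H) (m : Fin 2) : H :=
  (post.map fun z => 1 + η / (y - z)).prod •
    creation B (pre ++ post) ((A y).compLeft _ (slice m (moveFront η y pre ψ)))

theorem slice_slice_moveFront_cons (η y z : ℂ) (pre : List ℂ) (ψ : List (Fin 2) → H)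
    (m k : Fin 2) :
    slice k (slice m (moveFront η y (z :: pre) ψ)) =
      koszul k m • slice m (moveFront η y pre (slice k ψ)) +
        (η / (y - z)) • slice k (moveFront η y pre (slice m ψ)) := rfl

theorem slice_compLeft (X : Module.End ℂ H) (k : Fin 2) (ψ : List (Fin 2) → H) :
    slice k (X.compLeft _ ψ) = X.compLeft _ (slice k ψ) := rfl

theorem unwantedA_cons (z : ℂ) (pre : List ℂ) (y : ℂ) (post : List ℂ) (ψ : List (Fin 2) → H)
    (m : Fin 2) :
    unwantedA η A B (z :: pre) y post ψ m = ∑ k,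
      (koszul k m • B z k (unwantedA η A B pre y post (slice k ψ) m) +
        (η / (y - z)) • B z k (unwantedA η A B pre y post (slice m ψ) k)) := by
  simp only [unwantedA, List.cons_append, creation_cons, slice_compLeft,
    slice_slice_moveFront_cons, map_add, map_smul, Fin.sum_univ_two]
  module

/-- With a = η/(x-y), b = η/(x-z), c = η/(z-y), reordering B(z)B(x) leaves B_k(x)B_m(z) with the
coefficient ab - bc = -ac, that is, a times the parameter η/(y-z) of the exchange in `moveFront`. As
this exchange is not divided by 1 + η/(y-z), no factor has to be inverted. -/
theorem CreationRelations.unwantedA_step (h : CreationRelations η S A B D) {x y z : ℂ}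
    (hx : x ∈ S) (hz : z ∈ S) (hxy : x ≠ y) (hxz : x ≠ z) (hzy : z ≠ y) (pre post : List ℂ)
    (ψ : List (Fin 2) → H) :
    ∑ k, ((1 + η / (x - z)) • B z k ((η / (x - y)) •
          ∑ m, B x m (unwantedA η A B pre y post (slice k ψ) m)) -
        (η / (x - z)) • B x k ((η / (z - y)) •
          ∑ m, B z m (unwantedA η A B pre y post (slice k ψ) m))) =
      (η / (x - y)) • ∑ m, B x m (unwantedA η A B (z :: pre) y post ψ m) := by
  have e : η / (y - z) = -(η / (z - y)) := by rw [← neg_sub z y, div_neg]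
  have hp := partial_fractions η hxy hxz hzy
  simp only [unwantedA_cons, e]
  have r := fun k m => h.reorder hx hz hxz k m (unwantedA η A B pre y post (slice k ψ) m)
  have r00 := r 0 0
  have r01 := r 0 1
  have r10 := r 1 0
  have r11 := r 1 1
  simp only [Fin.sum_univ_two, map_add, map_smul, koszul_zero_left, koszul_zero_right,
    koszul_one_one] at *
  generalize η / (x - y) = a at *
  generalize η / (x - z) = b at *
  generalize η / (z - y) = c at *
  have p := fun k m => congrArg (fun t : ℂ => t • B x k (B z m
    (unwantedA η A B pre y post (slice k ψ) m))) hp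
  have p00 := p 0 0
  have p01 := p 0 1
  have p10 := p 1 0
  have p11 := p 1 1
  linear_combination (norm := module) a • r00 + a • r01 + a • r10 + a • r11
    + p00 + p01 + p10 + p11

theorem CreationRelations.A_creation (h : CreationRelations η S A B D) (ls : List ℂ)
    (hls : ∀ z ∈ ls, z ∈ S) (hnd : ls.Nodup) (x : ℂ) (hx : x ∈ S) (hxl : x ∉ ls)
    (ψ : List (Fin 2) → H) :
    A x (creation B ls ψ) =
      (ls.map fun z => 1 + η / (x - z)).prod • creation B ls ((A x).compLeft _ ψ) -
        sumSplits ls fun pre y post =>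
          (η / (x - y)) • ∑ m, B x m (unwantedA η A B pre y post ψ m) := by
  induction ls generalizing x ψ with
  | nil => simp [sumSplits, creation_nil]
  | cons z zs ih =>
    simp only [List.mem_cons, not_or, forall_eq_or_imp, List.nodup_cons] at *
    obtain ⟨hz, hzs⟩ := hls
    obtain ⟨hzn, hnd⟩ := hnd
    obtain ⟨hxz, hxn⟩ := hxl
    have step : (sumSplits zs fun pre y post =>
          (η / (x - y)) • ∑ m, B x m (unwantedA η A B (z :: pre) y post ψ m)) =
        ∑ k, ((1 + η / (x - z)) • B z k (sumSplits zs fun pre y post =>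
          (η / (x - y)) • ∑ m, B x m (unwantedA η A B pre y post (slice k ψ) m)) -
        (η / (x - z)) • B x k (sumSplits zs fun pre y post =>
          (η / (z - y)) • ∑ m, B z m (unwantedA η A B pre y post (slice k ψ) m))) := by
      simp only [map_sumSplits, smul_sumSplits, sub_sumSplits, Fin.sum_univ_two, sumSplits_add]
      refine sumSplits_congr fun pre y post e => ?_
      have hy : y ∈ zs := by simp [e]
      have := h.unwantedA_step hx hz (fun e => hxn (e ▸ hy)) hxz (fun e => hzn (e ▸ hy)) pre post ψ
      simp only [Fin.sum_univ_two] at this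
      exact this.symm
    -- The hypothesis is needed at x and also at z, since A(x)B(z) yields both A(x) and A(z) on the
    -- tail; the wanted part of the latter is the new split at z.
    have i1 := fun k => ih hzs hnd x hx hxn (slice k ψ)
    have i2 := fun k => ih hzs hnd z hz hzn (slice k ψ)
    simp only [sumSplits]
    rw [step]
    simp only [creation_cons, map_add, h.A_B x hx z hz hxz, i1, i2, map_sub,
      map_smul, Fin.sum_univ_two, List.map_cons, List.prod_cons, slice_compLeft]
    simp only [unwantedA, moveFront, Module.End.one_apply, List.nil_append, map_smul]
    module

/-- The vector multiplying `B_j(x)` in the term of `D^i_j(x) B(z_1) ⋯ B(z_N) ψ` where the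
parameters `x` and `y` are exchanged. -/
noncomputable def unwantedD (η : ℂ) (D : ℂ → Matrix (Fin 2) (Fin 2) (Module.End ℂ H))
    (B : ℂ → Fin 2 → Module.End ℂ H) : List ℂ → ℂ → List ℂ → (List (Fin 2) → H) → Fin 2 → H
  | [], y, post, ψ, i => (post.map fun z => z - y).prod⁻¹ •
      ∑ k, creation B post (monodromy η D y post i k (slice k ψ))
  | z :: pre, y, post, ψ, i => (1 + η / (z - y)) •
      ∑ k, koszul i k • B z k (unwantedD η D B pre y post (slice k ψ) i)

/-- With the same a, b, c, reordering gives the coefficient a(1-b), and the term in which D(z) meets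
the tail adds bc. The total a - ab + bc equals a(1+c), which explains the factor 1 + η/(z-y) in
`unwantedD`. -/
theorem CreationRelations.unwantedD_step (h : CreationRelations η S A B D) {x y z : ℂ}
    (hx : x ∈ S) (hz : z ∈ S) (hxy : x ≠ y) (hxz : x ≠ z) (hzy : z ≠ y) (i j : Fin 2)
    (w : Fin 2 → H) :
    ∑ k, ((koszul i k * koszul j k) • B z k ((η / (x - y) * koszul i j) • B x j (w k)) -
        (η / (x - z) * koszul i j) • (B z j ((η / (x - y) * koszul i k) • B x k (w k)) -
          B x j ((η / (z - y) * koszul i k) • B z k (w k)))) =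
      (η / (x - y) * koszul i j) • B x j ((1 + η / (z - y)) •
        ∑ k, koszul i k • B z k (w k)) := by
  have hp := partial_fractions η hxy hxz hzy
  have r := fun k => h.reorder' hx hz hxz j k (w k)
  have r0 := r 0
  have r1 := r 1
  simp only [Fin.sum_univ_two, map_add, map_smul] at *
  generalize η / (x - y) = a at *
  generalize η / (x - z) = b at *
  generalize η / (z - y) = c at *
  have p := fun k => congrArg (fun t : ℂ =>
    t • (koszul i j * koszul i k) • B x j (B z k (w k))) hp
  have p0 := p 0
  have p1 := p 1
  linear_combination (norm := module) (a * koszul i j * koszul i 0) • r0 +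
    (a * koszul i j * koszul i 1) • r1 - p0 - p1

/-- Passing B(z) multiplies D(x) by the graded 1 + η/(z-x) P, which is the regularised L-matrix
divided by z - x; the wanted terms thus assemble the monodromy matrix. -/
theorem CreationRelations.D_creation (h : CreationRelations η S A B D) (ls : List ℂ)
    (hls : ∀ z ∈ ls, z ∈ S) (hnd : ls.Nodup) (x : ℂ) (hx : x ∈ S) (hxl : x ∉ ls) (i j : Fin 2)
    (ψ : List (Fin 2) → H) :
    D x i j (creation B ls ψ) =
      (ls.map fun z => z - x).prod⁻¹ • creation B ls (monodromy η D x ls i j ψ) +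
        sumSplits ls fun pre y post =>
          (η / (x - y) * koszul i j) • B x j (unwantedD η D B pre y post ψ i) := by
  induction ls generalizing x j ψ with
  | nil => simp [sumSplits, creation_nil, monodromy_nil_apply]
  | cons z zs ih =>
    simp only [List.mem_cons, not_or, forall_eq_or_imp, List.nodup_cons] at *
    obtain ⟨hz, hzs⟩ := hls
    obtain ⟨hzn, hnd⟩ := hnd
    obtain ⟨hxz, hxn⟩ := hxl
    have step : (sumSplits zs fun pre y post =>
          (η / (x - y) * koszul i j) • B x j (unwantedD η D B (z :: pre) y post ψ i)) =
        ∑ k, ((koszul i k * koszul j k) • B z k (sumSplits zs fun pre y post =>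
            (η / (x - y) * koszul i j) • B x j (unwantedD η D B pre y post (slice k ψ) i)) -
          (η / (x - z) * koszul i j) • (B z j (sumSplits zs fun pre y post =>
            (η / (x - y) * koszul i k) • B x k (unwantedD η D B pre y post (slice k ψ) i)) -
          B x j (sumSplits zs fun pre y post =>
            (η / (z - y) * koszul i k) • B z k (unwantedD η D B pre y post (slice k ψ) i)))) := by
      simp only [map_sumSplits, smul_sumSplits, sub_sumSplits, Fin.sum_univ_two, sumSplits_add]
      refine sumSplits_congr fun pre y post e => ?_
      have hy : y ∈ zs := by simp [e]
      have := h.unwantedD_step hx hz (fun e => hxn (e ▸ hy)) hxz (fun e => hzn (e ▸ hy)) i j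
        fun k => unwantedD η D B pre y post (slice k ψ) i
      simp only [Fin.sum_univ_two] at this
      simp only [unwantedD, Fin.sum_univ_two]
      exact this.symm
    have i1 := fun j k => ih hzs hnd x hx hxn j (slice k ψ)
    have i2 := fun j k => ih hzs hnd z hz hzn j (slice k ψ)
    have hu : z - x ≠ 0 := sub_ne_zero.2 (Ne.symm hxz)
    have e : η / (x - z) = - (η / (z - x)) := by rw [← neg_sub z x, div_neg]
    obtain ⟨b, rfl⟩ : ∃ b, η = b * (z - x) := ⟨η / (z - x), by field_simp⟩
    rw [mul_div_cancel_right₀ _ hu] at e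
    simp only [sumSplits, step, creation_cons, map_add, h.D_B x hx z hz hxz, i1, i2,
      map_smul, Fin.sum_univ_two, List.map_cons, List.prod_cons, monodromy, slice_addSite,
      mul_inv, smul_add, smul_smul]
    have c1 : ∀ t : ℂ, (z - x)⁻¹ * t * (b * (z - x)) = t * b := fun t => by field_simp
    have c2 : ∀ t : ℂ, (z - x)⁻¹ * t * (z - x) = t := fun t => by field_simp
    simp only [unwantedD, Fin.sum_univ_two, smul_add, map_add, map_smul, e]
    rcases fin_two_eq j with rfl | rfl <;>
      simp only [if_true, zero_ne_one, one_ne_zero, if_false, mul_zero, zero_smul, ← mul_assoc,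
        c1, c2] <;> module

end Pass
end Creation
end GradedBethe

/-! ### Cancellation of the unwanted terms. -/

namespace GradedBethe

section OnShell

variable {H : Type*} [AddCommGroup H] [Module ℂ H] {η : ℂ} {S : Set ℂ} {A : ℂ → Module.End ℂ H}
  {B : ℂ → Fin 2 → Module.End ℂ H} {D : ℂ → Matrix (Fin 2) (Fin 2) (Module.End ℂ H)}

/-- Unitarity, site by site: with b = η/(z-y), the L-matrix 1 + bP of the site z at y meets the
exchange P - b from `moveFront`, and only the scalar (1-b)(1+b) survives. This puts the term in the
form of `unwantedA`, with y in front. -/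
theorem prod_smul_unwantedD {y : ℂ} (pre post : List ℂ) (hy : y ∉ pre) (ψ : List (Fin 2) → H)
    (i : Fin 2) :
    (pre.map fun z => 1 + η / (y - z)).prod • unwantedD η D B pre y post ψ i =
      ((pre ++ post).map fun z => z - y).prod⁻¹ •
        ∑ k, creation B (pre ++ post)
          (monodromy η D y (pre ++ post) i k (slice k (moveFront η y pre ψ))) := by
  induction pre generalizing ψ i with
  | nil => simp [unwantedD, moveFront]
  | cons z pre ih =>
    simp only [List.mem_cons, not_or] at hy
    have hu : z - y ≠ 0 := sub_ne_zero.2 (Ne.symm hy.1)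
    have e : η / (y - z) = - (η / (z - y)) := by rw [← neg_sub z y, div_neg]
    obtain ⟨b, rfl⟩ : ∃ b, η = b * (z - y) := ⟨η / (z - y), by field_simp⟩
    rw [mul_div_cancel_right₀ _ hu] at e
    have i1 := fun k => ih hy.2 (slice k ψ) i
    set Q := (pre.map fun z_1 => 1 + b * (z - y) / (y - z_1)).prod
    set U := fun k => unwantedD (b * (z - y)) D B pre y post (slice k ψ) i
    have e1 : ((z :: pre).map fun z_1 => 1 + b * (z - y) / (y - z_1)).prod •
        unwantedD (b * (z - y)) D B (z :: pre) y post ψ i =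
        ((1 - b) * (1 + b)) • ∑ k, koszul i k • B z k (Q • U k) := by
      simp only [unwantedD, List.map_cons, List.prod_cons, e, mul_div_cancel_right₀ _ hu,
        Fin.sum_univ_two, map_smul]
      module
    rw [e1]
    simp only [U, i1, Fin.sum_univ_two, List.cons_append, creation_cons, monodromy, slice_addSite,
      slice_slice_moveFront_cons, map_add, map_smul, e, List.map_cons, List.prod_cons, mul_inv,
      smul_add, smul_smul]
    have c1 : ∀ t : ℂ, (z - y)⁻¹ * t * (b * (z - y)) = t * b := fun t => by field_simp
    have c2 : ∀ t : ℂ, (z - y)⁻¹ * t * (z - y) = t := fun t => by field_simp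
    rcases fin_two_eq i with rfl | rfl <;>
      simp only [koszul_zero_left, koszul_zero_right, koszul_one_one, if_true, zero_ne_one,
        one_ne_zero, if_false, mul_zero, zero_mul, zero_smul, mul_one, ← mul_assoc, c1, c2] <;>
      module

theorem moveFront_compLeft (X : Module.End ℂ H) (η y : ℂ) (pre : List ℂ)
    (ψ : List (Fin 2) → H) :
    moveFront η y pre (X.compLeft _ ψ) = X.compLeft _ (moveFront η y pre ψ) := by
  induction pre generalizing ψ with
  | nil => rfl
  | cons z pre ih =>
    ext r
    rcases r with _ | ⟨m, _ | ⟨k, r⟩⟩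
    · exact (map_zero X).symm
    · exact (map_zero X).symm
    · change slice k (slice m (moveFront η y (z :: pre) (X.compLeft _ ψ))) r =
        X (slice k (slice m (moveFront η y (z :: pre) ψ)) r)
      simp only [slice_slice_moveFront_cons, slice_compLeft, ih]
      simp

/-- The factor η is kept because the site at y supplies it; thus c = 0 needs no separate treatment.
-/
theorem smul_unwanted_eq {pre post : List ℂ} {y a Λ : ℂ} {ψ : List (Fin 2) → H} (hy : y ∉ pre)
    (hpre : (pre.map fun z => 1 + η / (y - z)).prod ≠ 0)
    (hA : (A y).compLeft _ ψ = a • ψ)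
    (hD : monodromy η D y (pre ++ y :: post) 0 0 ψ - monodromy η D y (pre ++ y :: post) 1 1 ψ =
      Λ • ψ)
    (hΛ : η * a * ((pre ++ post).map fun z => 1 + η / (y - z)).prod =
      ((pre ++ post).map fun z => z - y).prod⁻¹ * Λ) (m : Fin 2) :
    η • unwantedA η A B pre y post ψ m = η • unwantedD η D B pre y post ψ m := by
  refine smul_right_injective _ hpre ?_
  have h1 := congrArg (fun w => slice m (moveFront η y pre w)) hD
  simp only [map_sub, map_smul, moveFront_monodromy _ _ _ hy, monodromy, slice_addSite] at h1
  -- The front site has X = y - y = 0, so only the permutation remains. Its sign `koszul m m`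
  -- cancels the sign of the supertrace, and one formula covers both values of m.
  have h2 : η • (monodromy η D y (pre ++ post) m 0 (slice 0 (moveFront η y pre ψ)) +
      monodromy η D y (pre ++ post) m 1 (slice 1 (moveFront η y pre ψ))) =
      Λ • slice m (moveFront η y pre ψ) := by
    rw [← h1]
    rcases fin_two_eq m with rfl | rfl <;> simp [add_comm]
  simp only
  rw [smul_comm _ η (unwantedD η D B pre y post ψ m), prod_smul_unwantedD _ _ hy, smul_comm η,
    Fin.sum_univ_two, ← map_add, ← map_smul, h2, unwantedA, ← slice_compLeft,
    ← moveFront_compLeft, hA]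
  simp only [map_smul, smul_smul]
  rw [← hΛ, List.map_append, List.prod_append]
  congr 1
  ring

/-- The nested Bethe ansatz: the action of the transfer matrix on a Bethe vector is diagonal if
the inner vector is an eigenvector of the inner transfer matrix and the outer Bethe equations
hold. -/
theorem CreationRelations.transfer_creation (h : CreationRelations η S A B D) (ls : List ℂ)
    (hls : ∀ z ∈ ls, z ∈ S) (hnd : ls.Nodup) (x : ℂ) (hx : x ∈ S) (hxl : x ∉ ls)
    {a Λ : ℂ → ℂ} {ψ : List (Fin 2) → H}
    (hA : ∀ y ∈ x :: ls, (A y).compLeft _ ψ = a y • ψ)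
    (hD : ∀ y ∈ x :: ls, monodromy η D y ls 0 0 ψ - monodromy η D y ls 1 1 ψ = Λ y • ψ)
    (hne : ∀ z ∈ ls, ∀ y ∈ ls, z ≠ y → y - z + η ≠ 0)
    (hΛ : ∀ pre y post, ls = pre ++ y :: post →
      η * a y * ((pre ++ post).map fun z => 1 + η / (y - z)).prod =
        ((pre ++ post).map fun z => z - y).prod⁻¹ * Λ y) :
    -A x (creation B ls ψ) - D x 0 0 (creation B ls ψ) + D x 1 1 (creation B ls ψ) =
      (-(a x * (ls.map fun z => 1 + η / (x - z)).prod) -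
        (ls.map fun z => z - x).prod⁻¹ * Λ x) • creation B ls ψ := by
  have key : (sumSplits ls fun pre y post =>
        (η / (x - y)) • ∑ m, B x m (unwantedA η A B pre y post ψ m)) =
      (sumSplits ls fun pre y post =>
        (η / (x - y) * koszul 0 0) • B x 0 (unwantedD η D B pre y post ψ 0)) -
      sumSplits ls fun pre y post =>
        (η / (x - y) * koszul 1 1) • B x 1 (unwantedD η D B pre y post ψ 1) := by
    rw [sub_sumSplits]
    refine sumSplits_congr fun pre y post e => ?_
    have hyl : y ∈ ls := by simp [e]
    have hy : y ∉ pre := by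
      rw [e, List.nodup_append] at hnd
      exact fun hm => hnd.2.2 y hm y (by simp) rfl
    have hpre : (pre.map fun z => 1 + η / (y - z)).prod ≠ 0 := by
      rw [Ne, List.prod_eq_zero_iff, List.mem_map]
      rintro ⟨z, hz, hz0⟩
      have hzy : z ≠ y := fun e => hy (e ▸ hz)
      have hu : y - z ≠ 0 := sub_ne_zero.2 hzy.symm
      refine hne z (by simp [e, hz]) y hyl hzy ?_
      field_simp at hz0
      simpa using hz0
    have hD' := hD y (by simp [hyl])
    rw [e] at hD'
    have hU := smul_unwanted_eq (B := B) hy hpre (hA y (by simp [hyl])) hD' (hΛ pre y post e)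
    have hU' : ∀ m, (η / (x - y)) • B x m (unwantedA η A B pre y post ψ m) =
        (η / (x - y)) • B x m (unwantedD η D B pre y post ψ m) := fun m => by
      rw [div_eq_inv_mul, mul_smul, mul_smul, ← map_smul, hU, map_smul]
    rw [Fin.sum_univ_two, smul_add, hU', hU', koszul_zero_left, koszul_one_one]
    module
  rw [h.A_creation ls hls hnd x hx hxl, h.D_creation ls hls hnd x hx hxl,
    h.D_creation ls hls hnd x hx hxl, hA x (by simp), map_smul, key]
  have hw := congrArg (creation B ls) (hD x (by simp))
  rw [map_sub, map_smul] at hw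
  have hw' := congrArg (fun w : H => -(ls.map fun z => z - x).prod⁻¹ • w) hw
  linear_combination (norm := module) hw'

end OnShell
end GradedBethe

/-! ### Exchange relations from the graded Yang–Baxter algebra. -/

namespace GradedBethe

theorem sgn_zero : sgn 0 = 1 := by simp [sgn]

theorem sgn_one : sgn 1 = -1 := by simp [sgn]

section Relations

variable {H : Type*} [AddCommGroup H] [Module ℂ H]

theorem Intertwines.apply {n : ℕ} {p : Fin n → ZMod 2} {c u : ℂ}
    {A B : Matrix (Fin n) (Fin n) (Module.End ℂ H)} (h : Intertwines p (rCheckReg p c u) A B)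
    (α β γ δ : Fin n) (v : H) :
    (u * sgn (p γ * p α) * sgn ((p γ + p β) * p α)) • A γ β (B α δ v) +
        (Complex.I * c * sgn ((p α + p β) * p γ)) • A α β (B γ δ v) =
      (u * sgn (p β * p δ) * sgn ((p α + p δ) * p γ)) • B α δ (A γ β v) +
        (Complex.I * c * sgn ((p α + p β) * p γ)) • B α β (A γ δ v) := by
  have e : ∀ r s : Fin n × Fin n, rCheckReg p c u r s =
      (if r.swap = s then u * sgn (p r.2 * p r.1) else 0) +
        (if r = s then Complex.I * c else 0) := by
    rintro ⟨r, r'⟩ ⟨s, s'⟩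
    simp [rCheckReg, switchRows, rOf, and_comm]
  -- The same entries with the sign read from the column, so that the sum on the other side of the
  -- relation collapses as well.
  have e' : ∀ r s : Fin n × Fin n, rCheckReg p c u r s =
      (if r = s.swap then u * sgn (p s.1 * p s.2) else 0) +
        (if r = s then Complex.I * c else 0) := by
    rintro ⟨r, r'⟩ ⟨s, s'⟩
    rw [e]
    congr 1
    simp only [Prod.swap, Prod.mk.injEq]
    by_cases hr : r' = s ∧ r = s'
    · rw [if_pos hr, if_pos hr.symm, hr.1, hr.2]
    · rw [if_neg hr, if_neg fun h => hr h.symm]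
  have h1 := congrFun (congrFun h (α, γ)) (β, δ)
  simp only [scalarMat, Matrix.mul_apply, Matrix.map_apply] at h1
  simp only [e (α, γ)] at h1
  simp only [e' _ (β, δ), map_add, add_mul (_ : Module.End ℂ H), mul_add (_ : Module.End ℂ H), Finset.sum_add_distrib, apply_ite
    (algebraMap ℂ (Module.End ℂ H)), map_zero, ite_mul, mul_ite, zero_mul, mul_zero,
    Finset.sum_ite_eq, Finset.sum_ite_eq', Finset.mem_univ, if_true, ← Algebra.smul_def,
    ← Algebra.commutes, gradedTensor, Prod.swap, smul_smul] at h1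
  exact LinearMap.congr_fun h1 v

variable {c : ℂ} {S : Set ℂ} {T : ℂ → Matrix (Fin 3) (Fin 3) (Module.End ℂ H)}

/-- Only parity differences matter for an entry: p(1) = p(2) ≠ p(3) makes B_1 even and B_2 odd,
whence the Koszul signs of the shifted indices 0 and 1. -/
theorem IsYangBaxterRep.creationRelations (hT : IsYangBaxterRep parityMMP c S T) :
    CreationRelations (Complex.I * c) S (fun x => T x 0 0) (fun x k => T x 0 k.succ)
      (fun x i j => T x i.succ j.succ) := by
  have z2 : (1 + 1 : ZMod 2) = 0 := rfl
  constructor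
  · intro x hx y hy j k v
    have h1 := (hT x hx y hy).apply 0 j.succ 0 k.succ v
    rcases fin_two_eq j with rfl | rfl <;> rcases fin_two_eq k with rfl | rfl <;>
      simp [parityMMP, sgn_zero, sgn_one, z2, -smul_eq_zero] at h1 ⊢ <;>
      first | linear_combination (norm := module) h1 | linear_combination (norm := module) -h1
  · intro x hx y hy hxy k v
    have hu : x - y ≠ 0 := sub_ne_zero.2 hxy
    have h1 := (hT y hy x hx).apply 0 k.succ 0 0 v
    obtain ⟨b, hb⟩ : ∃ b, Complex.I * c = b * (x - y) := ⟨Complex.I * c / (x - y), by field_simp⟩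
    rw [hb] at h1 ⊢
    rw [mul_div_cancel_right₀ _ hu, ← sub_eq_zero]
    refine (smul_eq_zero.1 (?_ : (x - y) • (_ : H) = 0)).resolve_left hu
    rcases fin_two_eq k with rfl | rfl <;>
      simp [parityMMP, sgn_zero, sgn_one, z2, -smul_eq_zero] at h1 ⊢ <;>
      first | linear_combination (norm := module) h1 | linear_combination (norm := module) -h1
  · intro x hx y hy hxy i j k v
    have hu : x - y ≠ 0 := sub_ne_zero.2 hxy
    have h1 := (hT x hx y hy).apply 0 j.succ i.succ k.succ v
    obtain ⟨b, hb⟩ : ∃ b, Complex.I * c = b * (x - y) := ⟨Complex.I * c / (x - y), by field_simp⟩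
    rw [hb] at h1 ⊢
    rw [mul_div_cancel_right₀ _ hu, ← sub_eq_zero]
    refine (smul_eq_zero.1 (?_ : (x - y) • (_ : H) = 0)).resolve_left hu
    rcases fin_two_eq i with rfl | rfl <;> rcases fin_two_eq j with rfl | rfl <;>
      rcases fin_two_eq k with rfl | rfl <;>
      simp [parityMMP, sgn_zero, sgn_one, z2, -smul_eq_zero] at h1 ⊢ <;>
      first | linear_combination (norm := module) h1 | linear_combination (norm := module) -h1

theorem IsYangBaxterRep.exchangeRelations (hT : IsYangBaxterRep parityMMP c S T) {x y : ℂ}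
    (hx : x ∈ S) (hy : y ∈ S) :
    ExchangeRelations (Complex.I * c) (x - y) (fun i j => T x i.succ j.succ)
      (fun i j => T y i.succ j.succ) := by
  have z2 : (1 + 1 : ZMod 2) = 0 := rfl
  intro α β γ δ v
  have h1 := (hT x hx y hy).apply α.succ β.succ γ.succ δ.succ v
  rcases fin_two_eq α with rfl | rfl <;> rcases fin_two_eq β with rfl | rfl <;>
    rcases fin_two_eq γ with rfl | rfl <;> rcases fin_two_eq δ with rfl | rfl <;>
    simp [parityMMP, sgn_zero, sgn_one, z2, -smul_eq_zero] at h1 ⊢ <;>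
    first | linear_combination (norm := module) h1 | linear_combination (norm := module) -h1

/-- The vectors annihilated by the `T^i_1(x)` and of weight `a(x)` for `T^1_1(x)`, for all `x` in
`S` outside a list of parameters. -/
def partialHighest (S : Set ℂ) (T : ℂ → Matrix (Fin 3) (Fin 3) (Module.End ℂ H)) (a : ℂ → ℂ)
    (mus : List ℂ) : Submodule ℂ H where
  carrier := {v | ∀ x ∈ S, x ∉ mus → T x 0 0 v = a x • v ∧ ∀ i : Fin 2, T x i.succ 0 v = 0}
  zero_mem' := by simp
  add_mem' := fun hv hw x hx hxm => by
    simp +contextual [hv x hx hxm, hw x hx hxm]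
  smul_mem' := fun r v hv x hx hxm => by
    simp [hv x hx hxm, smul_comm r]

/-- All exchange terms contain some T^k_1 or a commuting T^1_1 on v, so only the term carrying y - x
is left to be divided out. This excludes x = y, and the list of exceptions grows by y. -/
theorem IsYangBaxterRep.mem_partialHighest (hT : IsYangBaxterRep parityMMP c S T) {a : ℂ → ℂ}
    {mus : List ℂ} {y : ℂ} (hy : y ∈ S) (hym : y ∉ mus) {v : H}
    (hv : v ∈ partialHighest S T a mus) (i j : Fin 2) :
    T y i.succ j.succ v ∈ partialHighest S T a (y :: mus) := by
  have z2 : (1 + 1 : ZMod 2) = 0 := rfl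
  intro x hx hxm
  simp only [List.mem_cons, not_or] at hxm
  have hu : y - x ≠ 0 := sub_ne_zero.2 (Ne.symm hxm.1)
  obtain ⟨a1, c1⟩ := hv x hx hxm.2
  obtain ⟨a2, c2⟩ := hv y hy hym
  have hC : ∀ i j k : Fin 2, T x k.succ 0 (T y i.succ j.succ v) = 0 := by
    intro i j k
    have h1 := (hT y hy x hx).apply k.succ j.succ i.succ 0 v
    refine (smul_eq_zero.1 (?_ : (y - x) • (_ : H) = 0)).resolve_left hu
    simp only [c1, c2, map_zero, smul_zero, add_zero] at h1
    rcases fin_two_eq i with rfl | rfl <;> rcases fin_two_eq j with rfl | rfl <;>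
      rcases fin_two_eq k with rfl | rfl <;>
      simp [parityMMP, sgn_zero, sgn_one, z2, -smul_eq_zero] at h1 ⊢ <;>
      first | linear_combination (norm := module) h1 | linear_combination (norm := module) -h1
  refine ⟨?_, hC i j⟩
  have h1 := (hT y hy x hx).apply 0 j.succ i.succ 0 v
  rw [← sub_eq_zero]
  refine (smul_eq_zero.1 (?_ : (y - x) • (_ : H) = 0)).resolve_left hu
  simp only [a1, c1, c2, map_zero, smul_zero, add_zero, map_smul] at h1
  rcases fin_two_eq i with rfl | rfl <;> rcases fin_two_eq j with rfl | rfl <;>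
    simp [parityMMP, sgn_zero, sgn_one, z2, -smul_eq_zero] at h1 ⊢ <;>
    first | linear_combination (norm := module) h1 | linear_combination (norm := module) -h1

end Relations
end GradedBethe

/-! ### The graded L-matrices, site by site. -/

namespace GradedBethe

section Bridge

theorem sum_fin_cons {G : Type*} [AddCommMonoid G] {N : ℕ} (g : (Fin (N + 1) → Fin 2) → G) :
    ∑ i, g i = ∑ k, ∑ i', g (Fin.cons k i') := by
  rw [← (Fin.consEquiv fun _ : Fin (N + 1) => Fin 2).sum_comp, Fintype.sum_prod_type]
  rfl

theorem ofFn_cons {α : Type*} {N : ℕ} (k : α) (i : Fin N → α) :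
    List.ofFn (Fin.cons k i : Fin (N + 1) → α) = k :: List.ofFn i := by
  simp [List.ofFn_succ]

theorem cons_eq_cons_iff {N : ℕ} {m k : Fin 2} {r s : Fin N → Fin 2} :
    (Fin.cons m r : Fin (N + 1) → Fin 2) = Fin.cons k s ↔ m = k ∧ r = s :=
  Fin.cons_inj

/-- Adding a site in front, on which a matrix entry acts by its Koszul sign. -/
def liftMatrix {N : ℕ} (M : Matrix (Fin 2) (Fin 2) (Matrix (Fin N → Fin 2) (Fin N → Fin 2) ℂ)) :
    Matrix (Fin 2) (Fin 2) (Matrix (Fin (N + 1) → Fin 2) (Fin (N + 1) → Fin 2) ℂ) :=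
  Matrix.of fun n m => Matrix.of fun r s =>
    if r 0 = s 0 then koszul n (r 0) * koszul m (r 0) * M n m (Fin.tail r) (Fin.tail s) else 0

theorem liftMatrix_apply {N : ℕ}
    (M : Matrix (Fin 2) (Fin 2) (Matrix (Fin N → Fin 2) (Fin N → Fin 2) ℂ)) (n m k l : Fin 2)
    (r s : Fin N → Fin 2) :
    liftMatrix M n m (Fin.cons k r) (Fin.cons l s) =
      if k = l then koszul n k * koszul m k * M n m r s else 0 := rfl

/-- `liftMatrix` as a monoid homomorphism. -/
def liftSite (N : ℕ) :
    Matrix (Fin 2) (Fin 2) (Matrix (Fin N → Fin 2) (Fin N → Fin 2) ℂ) →*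
      Matrix (Fin 2) (Fin 2) (Matrix (Fin (N + 1) → Fin 2) (Fin (N + 1) → Fin 2) ℂ) where
  toFun := liftMatrix
  map_one' := by
    ext n m r s
    induction r using Fin.consCases with | _ r0 r
    induction s using Fin.consCases with | _ s0 s
    rw [liftMatrix_apply]
    by_cases h : n = m
    · subst h
      simp only [koszul_mul_self, one_mul, Matrix.one_apply_eq, Matrix.one_apply,
        cons_eq_cons_iff, ite_and]
    · simp [h]
  map_mul' M K := by
    ext n m r s
    induction r using Fin.consCases with | _ r0 r
    induction s using Fin.consCases with | _ s0 s
    have e : ∀ p, koszul n r0 * koszul m r0 =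
        koszul n r0 * koszul p r0 * (koszul p r0 * koszul m r0) := fun p => by
      linear_combination -(koszul n r0 * koszul m r0) * koszul_mul_self p r0
    simp only [liftMatrix_apply, Matrix.mul_apply, Matrix.sum_apply, sum_fin_cons, ite_mul,
      zero_mul, mul_ite, mul_zero]
    by_cases h : r0 = s0
    · subst h
      simp only [if_true, Finset.mul_sum]
      refine Finset.sum_congr rfl fun p _ => ?_
      rw [Finset.sum_eq_single r0 (by simp +contextual [eq_comm]) (by simp)]
      refine Finset.sum_congr rfl fun t _ => ?_
      rw [if_pos rfl, e p]
      simp only [if_true]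
      ring
    · rw [if_neg h]
      symm
      refine Finset.sum_eq_zero fun p _ => Finset.sum_eq_zero fun k _ =>
        Finset.sum_eq_zero fun t _ => ?_
      by_cases hk : r0 = k
      · subst hk
        simp [h]
      · simp [hk]

theorem liftSite_apply {N : ℕ}
    (M : Matrix (Fin 2) (Fin 2) (Matrix (Fin N → Fin 2) (Fin N → Fin 2) ℂ)) (n m k l : Fin 2)
    (r s : Fin N → Fin 2) :
    liftSite N M n m (Fin.cons k r) (Fin.cons l s) =
      if k = l then koszul n k * koszul m k * M n m r s else 0 := rfl

theorem sgn_parityPM (α β k : Fin 2) :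
    sgn ((parityPM α + parityPM β) * parityPM k) = koszul α k * koszul β k := by
  have z2 : (1 + 1 : ZMod 2) = 0 := rfl
  rcases fin_two_eq α with rfl | rfl <;> rcases fin_two_eq β with rfl | rfl <;>
    rcases fin_two_eq k with rfl | rfl <;> simp [parityPM, sgn_zero, sgn_one, z2]

theorem sgn_add (p q : ZMod 2) : sgn (p + q) = sgn p * sgn q := by
  have z2 : (1 + 1 : ZMod 2) = 0 := rfl
  obtain rfl | rfl : p = 0 ∨ p = 1 := by revert p; decide
  all_goals obtain rfl | rfl : q = 0 ∨ q = 1 := by revert q; decide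
  all_goals simp [sgn, z2]

/-- The first site splits off the sign ∑_{k<j} p(γ_k), leaving the Koszul sign used in `liftMatrix`.
-/
theorem eSite_succ {N : ℕ} (j : Fin N) (α β k l : Fin 2) (r s : Fin N → Fin 2) :
    eSite parityPM j.succ α β (Fin.cons k r) (Fin.cons l s) =
      if k = l then koszul α k * koszul β k * eSite parityPM j α β r s else 0 := by
  have e : (∑ x ∈ Finset.Iio j.succ, parityPM ((Fin.cons k r : Fin (N + 1) → Fin 2) x)) =
      parityPM k + ∑ x ∈ Finset.Iio j, parityPM (r x) := by
    rw [show Finset.Iio j.succ = insert 0 ((Finset.Iio j).map (Fin.succEmb N)) by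
      ext x
      induction x using Fin.cases <;> simp]
    rw [Finset.sum_insert (by simp), Finset.sum_map]
    simp
  simp only [eSite, Fin.cons_succ, e, mul_add, sgn_add, sgn_parityPM, Fin.forall_fin_succ,
    Fin.cons_zero, Fin.succ_inj, ne_eq]
  have h0 : ¬ (0 : Fin (N + 1)) = j.succ := (Fin.succ_ne_zero j).symm
  by_cases h : k = l <;> simp [h, h0]

theorem eSite_zero {N : ℕ} (α β k l : Fin 2) (r s : Fin N → Fin 2) :
    eSite (N := N + 1) parityPM 0 α β (Fin.cons k r) (Fin.cons l s) =
      if k = α ∧ l = β ∧ r = s then 1 else 0 := by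
  have e : Finset.Iio (0 : Fin (N + 1)) = ∅ := by ext x; simp
  simp [eSite, Fin.forall_fin_succ, sgn_zero, funext_iff, e]

theorem lMatrix_succ {N : ℕ} (c u : ℂ) (j : Fin N) :
    lMatrix c j.succ u = liftSite N (lMatrix c j u) := by
  ext n m r s
  induction r using Fin.consCases with | _ r0 r
  induction s using Fin.consCases with | _ s0 s
  rw [liftSite_apply]
  rcases fin_two_eq n with rfl | rfl <;> rcases fin_two_eq m with rfl | rfl <;>
    simp [lMatrix, eSite_succ, Matrix.one_apply, ite_and] <;>
    by_cases h : r0 = s0 <;> simp [h]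
  all_goals ring

theorem lMatrix_zero {N : ℕ} (c u : ℂ) (p j k l : Fin 2) (r s : Fin N → Fin 2) :
    lMatrix (N := N + 1) c 0 u p j (Fin.cons k r) (Fin.cons l s) =
      if r = s then (if p = j ∧ k = l then aFun c u else 0) +
        (if k = j ∧ p = l then bFun c u * koszul p j else 0) else 0 := by
  by_cases h : r = s <;>
  rcases fin_two_eq p with rfl | rfl <;> rcases fin_two_eq j with rfl | rfl <;>
    rcases fin_two_eq k with rfl | rfl <;> rcases fin_two_eq l with rfl | rfl <;>
    simp [lMatrix, eSite_zero, h, sub_eq_add_neg]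

end Bridge
end GradedBethe

/-! ### The nested monodromy matrix and the Bethe vector in list form. -/

namespace GradedBethe

section Bridge

/-- L_1 is the rightmost factor, so the first site splits off on the right, as in `addSite`. -/
theorem auxMonodromy_succ {N : ℕ} (c : ℂ) (lam : Fin (N + 1) → ℂ) (x : ℂ) :
    auxMonodromy c lam x =
      liftSite N (auxMonodromy c (Fin.tail lam) x) * lMatrix c 0 (lam 0 - x) := by
  rw [auxMonodromy, List.ofFn_succ, List.reverse_cons, List.prod_append, List.prod_singleton,
    auxMonodromy, map_list_prod, List.map_reverse, List.map_ofFn]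
  simp only [lMatrix_succ]
  rfl

theorem auxMonodromy_succ_apply {N : ℕ} (c : ℂ) (lam : Fin (N + 1) → ℂ) (x : ℂ)
    (n j m k : Fin 2) (r s : Fin N → Fin 2) :
    auxMonodromy c lam x n j (Fin.cons m r) (Fin.cons k s) =
      ∑ p, koszul n m * koszul p m * auxMonodromy c (Fin.tail lam) x n p r s *
        ((if p = j ∧ m = k then aFun c (lam 0 - x) else 0) +
          (if m = j ∧ p = k then bFun c (lam 0 - x) * koszul p j else 0)) := by
  rw [auxMonodromy_succ]
  simp only [Matrix.mul_apply, Matrix.sum_apply, sum_fin_cons, liftSite_apply, lMatrix_zero,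
    ite_mul, zero_mul, mul_ite, mul_zero, Finset.sum_ite_eq, Finset.sum_ite_eq',
    Finset.mem_univ, if_true]

variable {H : Type*} [AddCommGroup H] [Module ℂ H]

theorem sigmaZ_apply {N : ℕ} (r : Fin N → Fin 2) :
    (∏ j, (![1, -1] : Fin 2 → ℂ) (r j)) = ∏ j, koszul 1 (r j) := by
  refine Finset.prod_congr rfl fun j _ => ?_
  rcases fin_two_eq (r j) with h | h <;> simp [h]

/-- The σ^z strings in 𝒟 are the Koszul signs of its odd entries passing all N sites. -/
theorem nestedMonodromy_apply {N : ℕ} (c : ℂ) (T : ℂ → Matrix (Fin 3) (Fin 3) (Module.End ℂ H))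
    (lam : Fin N → ℂ) (x : ℂ) (i j : Fin 2) (r s : Fin N → Fin 2) :
    nestedMonodromy c T lam x i j r s =
      ∑ n, ((∏ k, koszul i (r k) * koszul n (r k)) * auxMonodromy c lam x n j r s) •
        T x i.succ n.succ := by
  have e : ∀ n t, dMatrix N T x i n r t =
      if r = t then (∏ k, koszul i (r k) * koszul n (r k)) • T x i.succ n.succ else 0 := by
    intro n t
    rcases fin_two_eq i with rfl | rfl <;> rcases fin_two_eq n with rfl | rfl <;>
      simp [dMatrix, tensorOp, sigmaZ, Matrix.one_apply, Matrix.diagonal_apply, sigmaZ_apply,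
        -koszul_one_one]
  rw [nestedMonodromy, Matrix.mul_apply, Matrix.sum_apply]
  refine Finset.sum_congr rfl fun n _ => ?_
  simp only [Matrix.mul_apply, e, ite_mul, zero_mul, Finset.sum_ite_eq, Finset.mem_univ, if_true,
    Matrix.map_apply, scalarMat]
  rw [← Algebra.commutes, ← Algebra.smul_def, smul_smul, mul_comm]

/-- The scalar collects the denominators of a and b. No pole is excluded: with 0⁻¹ = 0 both sides
vanish there. -/
theorem nestedMonodromy_act {N : ℕ} (c : ℂ) (T : ℂ → Matrix (Fin 3) (Fin 3) (Module.End ℂ H))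
    (lam : Fin N → ℂ) (x : ℂ) (i j : Fin 2) (r : Fin N → Fin 2) (f : List (Fin 2) → H) :
    ∑ s, nestedMonodromy c T lam x i j r s (f (List.ofFn s)) =
      (∏ k, (lam k - x + Complex.I * c))⁻¹ •
        monodromy (Complex.I * c) (fun x i j => T x i.succ j.succ) x (List.ofFn lam) i j f
          (List.ofFn r) := by
  induction N generalizing i j f with
  | zero =>
    obtain rfl : r = default := Subsingleton.elim _ _
    rw [Fintype.sum_unique]
    change _ = _ • T x i.succ j.succ (f [])
    have e : ∀ n r s, auxMonodromy c lam x n j r s = if n = j then 1 else 0 := fun n r s => by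
      obtain rfl := Subsingleton.elim r s
      simp only [auxMonodromy, List.ofFn_zero, List.reverse_nil, List.prod_nil]
      by_cases h : n = j
      · rw [h, Matrix.one_apply_eq, Matrix.one_apply_eq, if_pos rfl]
      · rw [Matrix.one_apply_ne h, if_neg h, Matrix.zero_apply]
    simp only [nestedMonodromy_apply, e, Finset.univ_eq_empty, Finset.prod_empty]
    rcases fin_two_eq j with rfl | rfl <;> simp
  | succ N ih =>
    induction r using Fin.consCases with | _ m r
    induction lam using Fin.consCases with | _ l0 l
    have ih' := fun p k => ih l i p r (slice k f)
    simp only [nestedMonodromy_apply, Fin.prod_univ_succ, Fin.cons_zero, Fin.cons_succ, Fin.tail_cons,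
      auxMonodromy_succ_apply, sum_fin_cons, ofFn_cons, slice_apply, monodromy,
      addSite_apply_cons] at ih' ⊢
    -- The sign of 𝒟 at the first site and the sign of the lift share the factor `koszul n m`, whose
    -- square is 1; the remaining sign does not depend on n.
    have key : ∀ k s, (∑ n, (((koszul i m * koszul n m) *
        ∏ t, koszul i (r t) * koszul n (r t)) *
        ∑ p, koszul n m * koszul p m * auxMonodromy c l x n p r s *
        ((if p = j ∧ m = k then aFun c (l0 - x) else 0) +
          (if m = j ∧ p = k then bFun c (l0 - x) * koszul p j else 0))) •
        T x i.succ n.succ) (f (k :: List.ofFn s)) =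
        ∑ p, (koszul i m * koszul p m * ((if p = j ∧ m = k then aFun c (l0 - x) else 0) +
          (if m = j ∧ p = k then bFun c (l0 - x) * koszul p j else 0))) •
          (∑ n, ((∏ t, koszul i (r t) * koszul n (r t)) *
            auxMonodromy c l x n p r s) • T x i.succ n.succ)
            (f (k :: List.ofFn s)) := by
      intro k s
      simp only [LinearMap.sum_apply, LinearMap.smul_apply, Finset.smul_sum, smul_smul]
      rw [Finset.sum_comm]
      refine Finset.sum_congr rfl fun n _ => ?_
      rw [← Finset.sum_smul]
      congr 1
      rw [Finset.mul_sum]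
      refine Finset.sum_congr rfl fun p _ => ?_
      linear_combination (koszul i m * koszul p m *
        ((if p = j ∧ m = k then aFun c (l0 - x) else 0) +
          (if m = j ∧ p = k then bFun c (l0 - x) * koszul p j else 0)) *
        ((∏ t, koszul i (r t) * koszul n (r t)) * auxMonodromy c l x n p r s)) *
        koszul_mul_self n m
    simp only [key]
    have e : ∀ k, ∑ s : Fin N → Fin 2, ∑ p, (koszul i m * koszul p m *
        ((if p = j ∧ m = k then aFun c (l0 - x) else 0) +
          (if m = j ∧ p = k then bFun c (l0 - x) * koszul p j else 0))) •
          (∑ n, ((∏ t, koszul i (r t) * koszul n (r t)) *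
            auxMonodromy c l x n p r s) • T x i.succ n.succ)
            (f (k :: List.ofFn s)) = ∑ p, (koszul i m * koszul p m *
        ((if p = j ∧ m = k then aFun c (l0 - x) else 0) +
          (if m = j ∧ p = k then bFun c (l0 - x) * koszul p j else 0))) •
          ((∏ k, (l k - x + Complex.I * c))⁻¹ •
            monodromy (Complex.I * c) (fun x i j => T x i.succ j.succ) x
              (List.ofFn l) i p (slice k f) (List.ofFn r)) := fun k => by
      rw [Finset.sum_comm]
      simp only [← Finset.smul_sum, ih']
    simp only [e]
    simp only [Fin.sum_univ_two]
    simp only [aFun, bFun, div_eq_mul_inv, mul_inv]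
    generalize monodromy (Complex.I * c) (fun x i j => T x i.succ j.succ) x (List.ofFn l) = M
    generalize (∏ k, (l k - x + Complex.I * c))⁻¹ = Z
    clear e key ih' ih
    rcases fin_two_eq i with rfl | rfl <;> rcases fin_two_eq j with rfl | rfl <;>
      rcases fin_two_eq m with rfl | rfl <;> simp <;> module

theorem algebraMap_auxVacuum (Ω : H) {N : ℕ} (r : Fin N → Fin 2) :
    algebraMap ℂ (Module.End ℂ H) (auxVacuum N r) Ω = tensorVacuum Ω N (List.ofFn r) := by
  induction N with
  | zero => simp [auxVacuum, tensorVacuum]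
  | succ N ih =>
    induction r using Fin.consCases with | _ m r
    have := ih r
    rw [ofFn_cons, tensorVacuum, ← this]
    rcases fin_two_eq m with rfl | rfl <;> simp [auxVacuum, Fin.prod_univ_succ]

theorem nestedVector_aux (Ω : H) {N : ℕ} (c : ℂ)
    (T : ℂ → Matrix (Fin 3) (Fin 3) (Module.End ℂ H)) (lam : Fin N → ℂ) (ms : List ℂ)
    (r : Fin N → Fin 2) :
    ((ms.map fun y => nestedMonodromy c T lam y 0 1).prod.mulVec
        fun i => algebraMap ℂ (Module.End ℂ H) (auxVacuum N i)) r Ω =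
      (ms.map fun y => (∏ k, (lam k - y + Complex.I * c))⁻¹).prod •
        (ms.map fun y => monodromy (Complex.I * c) (fun x i j => T x i.succ j.succ) y
          (List.ofFn lam) 0 1).prod (tensorVacuum Ω N) (List.ofFn r) := by
  induction ms generalizing r with
  | nil => simpa using algebraMap_auxVacuum Ω r
  | cons y ys ih =>
    simp only [List.map_cons, List.prod_cons, ← Matrix.mulVec_mulVec, Module.End.mul_apply]
    rw [Matrix.mulVec, dotProduct, LinearMap.sum_apply]
    simp only [Module.End.mul_apply, ih, map_smul]
    rw [← Finset.smul_sum, nestedMonodromy_act, smul_smul, mul_comm]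

theorem creation_ofFn (B : ℂ → Fin 2 → Module.End ℂ H) {N : ℕ} (lam : Fin N → ℂ)
    (f : List (Fin 2) → H) :
    creation B (List.ofFn lam) f =
      ∑ i : Fin N → Fin 2, (List.ofFn fun j => B (lam j) (i j)).prod (f (List.ofFn i)) := by
  induction N generalizing f with
  | zero => simp [creation_nil]
  | succ N ih =>
    rw [List.ofFn_succ, creation_cons, sum_fin_cons, Fin.sum_univ_two]
    simp [ih, List.ofFn_succ]

theorem betheVector_eq {N M : ℕ} (c : ℂ) (T : ℂ → Matrix (Fin 3) (Fin 3) (Module.End ℂ H))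
    (Ω : H) (lam : Fin N → ℂ) (mu : Fin M → ℂ) :
    betheVector c T Ω lam mu =
      ((List.ofFn mu).map fun y => (∏ k, (lam k - y + Complex.I * c))⁻¹).prod •
        creation (fun x k => T x 0 k.succ) (List.ofFn lam)
          (((List.ofFn mu).map fun y =>
            monodromy (Complex.I * c) (fun x i j => T x i.succ j.succ) y
              (List.ofFn lam) 0 1).prod (tensorVacuum Ω N)) := by
  rw [creation_ofFn, betheVector, Finset.smul_sum]
  refine Finset.sum_congr rfl fun i _ => ?_
  rw [← map_smul, ← nestedVector_aux, nestedVector, List.map_ofFn]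
  rfl

end Bridge
end GradedBethe

/-! ### The Bethe equations and the conclusion. -/

namespace GradedBethe

section Final

variable {H : Type*} [AddCommGroup H] [Module ℂ H]

theorem monodromy_mem {η x : ℂ} {D : ℂ → Matrix (Fin 2) (Fin 2) (Module.End ℂ H)}
    {W W' : Submodule ℂ H} (h : ∀ i j, ∀ v ∈ W, D x i j v ∈ W') (zs : List ℂ) (i j : Fin 2)
    (ψ : List (Fin 2) → H) (hψ : ∀ r, ψ r ∈ W) (r : List (Fin 2)) :
    monodromy η D x zs i j ψ r ∈ W' := by
  induction zs generalizing i j ψ r with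
  | nil => exact h i j _ (hψ r)
  | cons z zs ih =>
    rcases r with _ | ⟨m, r⟩
    · exact W'.zero_mem
    · rw [monodromy, addSite_apply_cons]
      have hs : ∀ k r, slice k ψ r ∈ W := fun k r => hψ (k :: r)
      exact W'.add_mem (W'.smul_mem _ (ih _ _ _ (hs _) _))
        (W'.smul_mem _ (W'.add_mem (ih _ _ _ (hs _) _) (ih _ _ _ (hs _) _)))

theorem tensorVacuum_mem {W : Submodule ℂ H} {Ω : H} (h : Ω ∈ W) (n : ℕ) (r : List (Fin 2)) :
    tensorVacuum Ω n r ∈ W := by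
  induction n generalizing r with
  | zero => rcases r with _ | _ <;> simp [tensorVacuum, h]
  | succ n ih =>
    rcases r with _ | ⟨m, r⟩
    · simp [tensorVacuum]
    · rw [tensorVacuum]
      split_ifs
      exacts [ih r, W.zero_mem]

theorem IsYangBaxterRep.nested_mem_partialHighest {c : ℂ} {S : Set ℂ}
    {T : ℂ → Matrix (Fin 3) (Fin 3) (Module.End ℂ H)} (hT : IsYangBaxterRep parityMMP c S T)
    {a : ℂ → ℂ} {Ω : H} (hΩ : Ω ∈ partialHighest S T a []) (ls : List ℂ) (n : ℕ) (ms : List ℂ)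
    (hms : ∀ y ∈ ms, y ∈ S) (hnd : ms.Nodup) (r : List (Fin 2)) :
    (ms.map fun y => monodromy (Complex.I * c) (fun x i j => T x i.succ j.succ) y ls 0 1).prod
      (tensorVacuum Ω n) r ∈ partialHighest S T a ms := by
  induction ms generalizing r with
  | nil => exact tensorVacuum_mem hΩ n r
  | cons y ys ih =>
    simp only [List.mem_cons, forall_eq_or_imp, List.nodup_cons] at hms hnd
    rw [List.map_cons, List.prod_cons, Module.End.mul_apply]
    exact monodromy_mem (fun i j v hv => hT.mem_partialHighest hms.1 hnd.1 hv i j) _ _ _ _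
      (ih hms.2 hnd.2) _

theorem one_div_aFun (c v : ℂ) : 1 / aFun c v = (v + Complex.I * c) / v := by
  rw [aFun, one_div_div]

/-- Factorwise, a(y-z)/a(z-y) times 1/a(y-z) is 1/a(z-y). This turns the right side of the first
Bethe equations into the scalars of the inner problem. -/
theorem bethe_prod_identity (η y : ℂ) (L : List ℂ) (hL : ∀ z ∈ L, y - z ≠ 0 ∧ y - z + η ≠ 0) :
    (L.map fun z => (y - z) / (y - z + η) / ((z - y) / (z - y + η))).prod *
        (L.map fun z => 1 + η / (y - z)).prod =
      (L.map fun z => z - y).prod⁻¹ * (L.map fun z => z - y + η).prod := by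
  induction L with
  | nil => simp
  | cons z L ih =>
    obtain ⟨h1, h2⟩ := hL z (by simp)
    have h3 : z - y ≠ 0 := by rwa [← neg_sub, neg_ne_zero]
    have e : (y - z) / (y - z + η) / ((z - y) / (z - y + η)) * (1 + η / (y - z)) =
        (z - y)⁻¹ * (z - y + η) := by
      rw [div_div_eq_mul_div]
      field_simp
    simp only [List.map_cons, List.prod_cons, mul_inv]
    linear_combination ((y - z) / (y - z + η) / ((z - y) / (z - y + η)) * (1 + η / (y - z))) *
      ih (fun w hw => hL w (by simp [hw])) +
      ((L.map fun z => z - y).prod⁻¹ * (L.map fun z => z - y + η).prod) * e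

/-- Translates the products over l ≠ j in the Bethe equations into products over the splits in
`sumSplits`. -/
theorem prod_erase_eq_of_ofFn {N : ℕ} {lam : Fin N → ℂ} (hinj : Function.Injective lam)
    {pre post : List ℂ} {y : ℂ} (e : List.ofFn lam = pre ++ y :: post) (g : ℂ → ℂ) :
    ∃ j, lam j = y ∧ ∏ l ∈ Finset.univ.erase j, g (lam l) = ((pre ++ post).map g).prod := by
  obtain ⟨j, hj⟩ : ∃ j, lam j = y := by
    have : y ∈ List.ofFn lam := by simp [e]
    simpa [List.mem_ofFn] using this
  have hnd : (y :: (pre ++ post)).Nodup := by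
    rw [← (List.perm_middle (a := y) (l₁ := pre) (l₂ := post)).nodup_iff, ← e]
    exact List.nodup_ofFn.2 hinj
  refine ⟨j, hj, ?_⟩
  rw [← List.prod_toFinset g (List.nodup_cons.1 hnd).2,
    ← Finset.prod_image (s := Finset.univ.erase j) (g := lam) (f := g) hinj.injOn]
  refine Finset.prod_congr ?_ fun _ _ => rfl
  ext z
  have h1 : z ∈ List.ofFn lam ↔ z ∈ pre ++ y :: post := by rw [e]
  have hy := (List.nodup_cons.1 hnd).1
  simp only [List.mem_ofFn, List.mem_append, List.mem_cons] at h1 hy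
  simp only [Finset.mem_image, Finset.mem_erase, Finset.mem_univ, and_true, List.mem_toFinset,
    List.mem_append]
  constructor
  · rintro ⟨l, hl, rfl⟩
    have hly : lam l ≠ y := fun h => hl (hinj (h.trans hj.symm))
    have := h1.1 ⟨l, rfl⟩
    tauto
  · intro hz
    obtain ⟨l, rfl⟩ := h1.2 (by tauto)
    refine ⟨l, ?_, rfl⟩
    rintro rfl
    rw [hj] at hz
    exact hy hz

theorem transferMatrix_betheVector (c : ℂ) (S : Set ℂ)
    (T : ℂ → Matrix (Fin 3) (Fin 3) (Module.End ℂ H))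
    (hT : IsYangBaxterRep parityMMP c S T)
    (a : Fin 3 → ℂ → ℂ) (Ω : H) (hΩ : IsHighestVector S T a Ω)
    (N M : ℕ) (lam : Fin N → ℂ) (mu : Fin M → ℂ)
    (hlam : ∀ j, lam j ∈ S) (hmu : ∀ k, mu k ∈ S)
    (hB : BetheEquationsMMP c a lam mu) (x : ℂ) (hx : x ∈ S) (hxl : ∀ j, x ≠ lam j)
    (hxm : ∀ k, x ≠ mu k) :
    transferMatrix parityMMP T x (betheVector c T Ω lam mu) =
      eigenvalueMMP c a lam mu x • betheVector c T Ω lam mu := by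
  rw [betheVector_eq, map_smul, smul_comm]
  congr 1
  set η := Complex.I * c with hη
  set D : ℂ → Matrix (Fin 2) (Fin 2) (Module.End ℂ H) := fun x i j => T x i.succ j.succ with hD
  set B : ℂ → Fin 2 → Module.End ℂ H := fun x k => T x 0 k.succ with hBdef
  set ls := List.ofFn lam with hls
  set ms := List.ofFn mu with hms
  set φ := (ms.map fun y => monodromy η D y ls 0 1).prod (tensorVacuum Ω N) with hφ
  have hlsS : ∀ z ∈ ls, z ∈ S := by
    intro z hz
    obtain ⟨j, rfl⟩ := List.mem_ofFn.1 hz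
    exact hlam j
  have hmsS : ∀ z ∈ ms, z ∈ S := by
    intro z hz
    obtain ⟨j, rfl⟩ := List.mem_ofFn.1 hz
    exact hmu j
  have hmsnd : ms.Nodup := List.nodup_ofFn.2 hB.mu_injective
  have hxls : x ∉ ls := by
    intro hz
    obtain ⟨j, hj⟩ := List.mem_ofFn.1 hz
    exact hxl j hj.symm
  have hout : ∀ y ∈ x :: ls, y ∈ S ∧ y ∉ ms := by
    intro y hy
    rcases List.mem_cons.1 hy with rfl | hy
    · refine ⟨hx, fun hz => ?_⟩
      obtain ⟨k, hk⟩ := List.mem_ofFn.1 hz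
      exact hxm k hk.symm
    · refine ⟨hlsS y hy, fun hz => ?_⟩
      obtain ⟨k, hk⟩ := List.mem_ofFn.1 hz
      obtain ⟨j, hj⟩ := List.mem_ofFn.1 hy
      exact hB.lam_ne_mu j k (hj.trans hk.symm)
  have hΩmem : Ω ∈ partialHighest S T (a 0) [] := fun y hy _ =>
    ⟨hΩ.diag y hy 0, fun i => hΩ.lower y hy _ _ (Fin.succ_pos i)⟩
  have hA : ∀ y ∈ x :: ls, (T y 0 0).compLeft _ φ = a 0 y • φ := by
    intro y hy
    ext r
    exact (hT.nested_mem_partialHighest hΩmem ls N ms hmsS hmsnd r y (hout y hy).1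
      (hout y hy).2).1
  set Γ : ℂ → ℂ := fun y =>
    a 1 y * (ls.map fun z => z - y + η).prod - a 2 y * (ls.map fun z => z - y).prod with hΓ
  have hvac : ∀ y ∈ S, monodromy η D y ls 0 0 (tensorVacuum Ω N) -
      monodromy η D y ls 1 1 (tensorVacuum Ω N) = Γ y • tensorVacuum Ω N := by
    intro y hy
    have h := monodromy_tensorVacuum (η := η) (D := D) (x := y) (hΩ.diag y hy 1)
      (hΩ.diag y hy 2) (hΩ.lower y hy 2 1 (by decide)) ls
    rw [show ls.length = N from List.length_ofFn] at h
    rw [h.1, h.2.1, ← sub_smul]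
  -- This is the second set of Bethe equations with denominators cleared.
  have hΓmu : ∀ y ∈ ms, Γ y = 0 := by
    intro y hy
    obtain ⟨k, rfl⟩ := List.mem_ofFn.1 hy
    have h := hB.eq_mu k
    have hne : ∏ j, (lam j - mu k) ≠ 0 :=
      Finset.prod_ne_zero_iff.2 fun j _ => sub_ne_zero.2 (hB.lam_ne_mu j k)
    simp only [one_div_aFun, Finset.prod_div_distrib] at h
    rw [div_eq_div_iff (hB.a_mu_ne_zero k) hne] at h
    simp only [hΓ, hls, List.map_ofFn, List.prod_ofFn, Function.comp_def]
    linear_combination -h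
  set F : ℂ → ℂ := fun y => (ms.map fun m => (y - m + η) / (y - m)).prod with hF
  have hDφ : ∀ y ∈ x :: ls, monodromy η D y ls 0 0 φ - monodromy η D y ls 1 1 φ =
      (Γ y * F y) • φ := fun y hy =>
    supertrace_bethe (M := fun y => monodromy η D y ls)
      (fun x hx y hy => monodromy_exchange (hT.exchangeRelations hx hy) ls) _ Γ hvac ms hmsnd hmsS
      hΓmu y (hout y hy).1 (hout y hy).2
  have hne : ∀ z ∈ ls, ∀ y ∈ ls, z ≠ y → y - z + η ≠ 0 := by
    intro z hz y hy hzy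
    obtain ⟨j, rfl⟩ := List.mem_ofFn.1 hz
    obtain ⟨l, rfl⟩ := List.mem_ofFn.1 hy
    exact hB.lam_lam_pole l j fun e => hzy (by rw [e])
  have hout' : ∀ pre y post, ls = pre ++ y :: post →
      η * a 0 y * ((pre ++ post).map fun z => 1 + η / (y - z)).prod =
        ((pre ++ post).map fun z => z - y).prod⁻¹ * (Γ y * F y) := by
    intro pre y post e
    obtain ⟨j, rfl, hj⟩ := prod_erase_eq_of_ofFn hB.lam_injective e
      (fun z => (y - z) / (y - z + η) / ((z - y) / (z - y + η)))
    have hnd : (lam j :: (pre ++ post)).Nodup := by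
      rw [← (List.perm_middle (a := lam j) (l₁ := pre) (l₂ := post)).nodup_iff, ← e]
      exact List.nodup_ofFn.2 hB.lam_injective
    have hperm : ls.Perm (lam j :: (pre ++ post)) := e ▸ List.perm_middle
    have hL : ∀ z ∈ pre ++ post, lam j - z ≠ 0 ∧ lam j - z + η ≠ 0 := by
      intro z hz
      have hzj : z ≠ lam j := fun h => (List.nodup_cons.1 hnd).1 (h ▸ hz)
      exact ⟨sub_ne_zero.2 hzj.symm, hne z (hperm.mem_iff.2 (List.mem_cons_of_mem _ hz)) _
        (hperm.mem_iff.2 List.mem_cons_self) hzj⟩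
    have hid := bethe_prod_identity η (lam j) (pre ++ post) hL
    have hb := hB.eq_lam j
    simp only [one_div_aFun] at hb
    simp only [aFun, ← hη] at hb
    rw [hj, div_eq_iff (hB.a_lam_ne_zero j)] at hb
    -- At y = λ_j the product of the z - y contains a zero, which removes a_3, and the product of
    -- the z - y + η contains the factor η.
    have hΓj : Γ (lam j) = η * (a 1 (lam j) *
        ((pre ++ post).map fun z => z - lam j + η).prod) := by
      simp only [hΓ]
      rw [(hperm.map _).prod_eq, (hperm.map _).prod_eq]
      simp only [List.map_cons, List.prod_cons]
      ring
    have hFj : F (lam j) = ∏ k, (lam j - mu k + η) / (lam j - mu k) := by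
      simp only [hF, hms, List.map_ofFn, List.prod_ofFn, Function.comp_def]
    rw [hΓj, hFj, hb]
    linear_combination (η * a 1 (lam j) * ∏ k, (lam j - mu k + η) / (lam j - mu k)) * hid
  have main := hT.creationRelations.transfer_creation ls hlsS
    (List.nodup_ofFn.2 hB.lam_injective) x hx hxls hA hDφ hne hout'
  have ht : transferMatrix parityMMP T x (creation B ls φ) =
      -T x 0 0 (creation B ls φ) - D x 0 0 (creation B ls φ) + D x 1 1 (creation B ls φ) := by
    simp [transferMatrix, Fin.sum_univ_three, parityMMP, sgn_zero, sgn_one, hD, sub_eq_add_neg]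
  rw [ht, main]
  congr 1
  have hne' : ∏ j, (lam j - x) ≠ 0 :=
    Finset.prod_ne_zero_iff.2 fun j _ => sub_ne_zero.2 (hxl j).symm
  have h1 : ∀ j, 1 + η / (x - lam j) = (x - lam j + η) / (x - lam j) := fun j => by
    rw [add_div, div_self (sub_ne_zero.2 (hxl j))]
  simp only [eigenvalueMMP, one_div_aFun, ← hη, hΓ, hF, hls, hms, List.map_ofFn, List.prod_ofFn,
    Function.comp_def, h1]
  rw [Finset.prod_div_distrib (f := fun j => lam j - x + η)]
  field_simp
  ring

end Final
end GradedBethe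

theorem mainTheorem1 {H : Type*} [AddCommGroup H] [Module ℂ H] (c : ℂ) (S : Set ℂ)
    (T : ℂ → Matrix (Fin 3) (Fin 3) (Module.End ℂ H))
    (hT : GradedBethe.IsYangBaxterRep GradedBethe.parityMMP c S T)
    (a : Fin 3 → ℂ → ℂ) (Ω : H) (hΩ : GradedBethe.IsHighestVector S T a Ω)
    (N M : ℕ) (lam : Fin N → ℂ) (mu : Fin M → ℂ)
    (hlam : ∀ j, lam j ∈ S) (hmu : ∀ k, mu k ∈ S)
    (hB : GradedBethe.BetheEquationsMMP c a lam mu) :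
    ∀ x ∈ S, (∀ j, x ≠ lam j) → (∀ k, x ≠ mu k) →
      GradedBethe.transferMatrix GradedBethe.parityMMP T x
          (GradedBethe.betheVector c T Ω lam mu) =
        GradedBethe.eigenvalueMMP c a lam mu x • GradedBethe.betheVector c T Ω lam mu ∧
      (GradedBethe.betheVector c T Ω lam mu ≠ 0 →
        Module.End.HasEigenvector (GradedBethe.transferMatrix GradedBethe.parityMMP T x)
          (GradedBethe.eigenvalueMMP c a lam mu x) (GradedBethe.betheVector c T Ω lam mu)) := by
  intro x hx hxl hxm
  have h := GradedBethe.transferMatrix_betheVector c S T hT a Ω hΩ N M lam mu hlam hmu hB x hx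
    hxl hxm
  exact ⟨h, fun hne => ⟨Module.End.mem_eigenspace_iff.2 h, hne⟩⟩
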